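/- Let $G$ be a compact Lie group and let $\pi : P \to \Sigma$ be a smooth principal $G$-bundle over a smooth surface $\Sigma$ of genus $1$ (that is, $\Sigma$ is diffeomorphic to the $2$-dimensional torus). Let $\mathrm{Aut}(P)$ be the group of $G$-equivariant diffeomorphisms $P \to P$ covering a diffeomorphism of $\Sigma$, with the compact-open topology. Let $\gamma : \mathbb{C} \to \mathrm{Aut}(P)$ be a frame in $P$, that is, a continuous group homomorphism such that the induced action of $\mathbb{C}$ on $\Sigma$ is transitive. Then the closure $\overline{\gamma(\mathbb{C})}$ of the image of $\gamma$ in $\mathrm{Aut}(P)$ is compact. Moreover, there is a torus $T \leq \mathrm{Aut}(P)$ (a closed subgroup isomorphic, as a topological group, to $(S^1)^n$ for some $n \geq 0$) such that $\gamma(\mathbb{C}) \subseteq T$, so that $\gamma$ factors through $T$. -/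

import Mathlib

open scoped Manifold ContDiff

/-- A smooth (right) principal `G`-bundle `proj : P → S`. The manifolds are modelled on `IG`, `IP`
and `IS`. -/
structure SmoothPrincipalBundle
    {EG HG EP HP ES HS : Type*}
    [NormedAddCommGroup EG] [NormedSpace ℝ EG] [TopologicalSpace HG]
    [NormedAddCommGroup EP] [NormedSpace ℝ EP] [TopologicalSpace HP]
    [NormedAddCommGroup ES] [NormedSpace ℝ ES] [TopologicalSpace HS]
    (IG : ModelWithCorners ℝ EG HG) (IP : ModelWithCorners ℝ EP HP) (IS : ModelWithCorners ℝ ES HS)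
    (G P S : Type*)
    [TopologicalSpace G] [ChartedSpace HG G] [Group G]
    [TopologicalSpace P] [ChartedSpace HP P]
    [TopologicalSpace S] [ChartedSpace HS S] where
  /-- the bundle projection -/
  proj : P → S
  /-- the right action of the structure group on the total space, `act p g = p · g` -/
  act : P → G → P
  act_one : ∀ p, act p 1 = p
  act_mul : ∀ p g h, act p (g * h) = act (act p g) h
  contMDiff_proj : ContMDiff IP IS ∞ proj
  contMDiff_act : ContMDiff (IP.prod IG) IP ∞ (fun q : P × G => act q.1 q.2)
  proj_act : ∀ p g, proj (act p g) = proj p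
  /-- around every point of the base there is a smooth `G`-equivariant local trivialization -/
  locally_trivial : ∀ b : S, ∃ e : Bundle.Trivialization G proj, b ∈ e.baseSet ∧
    ContMDiffOn IP (IS.prod IG) ∞ e e.source ∧
    ContMDiffOn (IS.prod IG) IP ∞ e.toOpenPartialHomeomorph.symm e.target ∧
    ∀ p ∈ e.source, ∀ g : G, (e (act p g)).2 = (e p).2 * g

section

variable
    {EG HG EP HP ES HS : Type*}
    [NormedAddCommGroup EG] [NormedSpace ℝ EG] [TopologicalSpace HG]
    [NormedAddCommGroup EP] [NormedSpace ℝ EP] [TopologicalSpace HP]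
    [NormedAddCommGroup ES] [NormedSpace ℝ ES] [TopologicalSpace HS]
    {IG : ModelWithCorners ℝ EG HG} {IP : ModelWithCorners ℝ EP HP} {IS : ModelWithCorners ℝ ES HS}
    {G P S : Type*}
    [TopologicalSpace G] [ChartedSpace HG G] [Group G]
    [TopologicalSpace P] [ChartedSpace HP P]
    [TopologicalSpace S] [ChartedSpace HS S]

/-- An automorphism of a principal bundle: a `G`-equivariant diffeomorphism of the total space
covering a diffeomorphism of the base. -/
structure BundleAut (ξ : SmoothPrincipalBundle IG IP IS G P S) where
  toDiffeo : P ≃ₘ⟮IP, IP⟯ P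
  /-- the diffeomorphism of the base that is covered -/
  baseDiffeo : S ≃ₘ⟮IS, IS⟯ S
  map_act : ∀ p g, toDiffeo (ξ.act p g) = ξ.act (toDiffeo p) g
  covers : ∀ p, ξ.proj (toDiffeo p) = baseDiffeo (ξ.proj p)

namespace BundleAut

variable {ξ : SmoothPrincipalBundle IG IP IS G P S}

theorem proj_surjective (ξ : SmoothPrincipalBundle IG IP IS G P S) :
    Function.Surjective ξ.proj := by
  intro b
  obtain ⟨e, hb, -⟩ := ξ.locally_trivial b
  exact ⟨e.toOpenPartialHomeomorph.symm (b, 1), e.proj_symm_apply' hb⟩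

/-- An automorphism is determined by its map on the total space. -/
theorem ext_total {f g : BundleAut ξ} (h : ∀ p, f.toDiffeo p = g.toDiffeo p) : f = g := by
  have h1 : f.toDiffeo = g.toDiffeo := Diffeomorph.ext h
  have h2 : f.baseDiffeo = g.baseDiffeo := by
    refine Diffeomorph.ext fun b => ?_
    obtain ⟨p, rfl⟩ := proj_surjective ξ b
    rw [← f.covers, ← g.covers, h]
  cases f
  cases g
  simp_all

/-- The group of bundle automorphisms, with composition as multiplication. -/
noncomputable instance : Group (BundleAut ξ) where
  mul f g :=
    { toDiffeo := g.toDiffeo.trans f.toDiffeo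
      baseDiffeo := g.baseDiffeo.trans f.baseDiffeo
      map_act := fun p x => by simp [g.map_act, f.map_act]
      covers := fun p => by simp [g.covers, f.covers] }
  one :=
    { toDiffeo := Diffeomorph.refl IP P ∞
      baseDiffeo := Diffeomorph.refl IS S ∞
      map_act := fun p x => by simp
      covers := fun p => by simp }
  inv f :=
    { toDiffeo := f.toDiffeo.symm
      baseDiffeo := f.baseDiffeo.symm
      map_act := fun p x => f.toDiffeo.injective (by simp [f.map_act])
      covers := fun p => f.baseDiffeo.injective (by simp [← f.covers]) }
  mul_assoc _ _ _ := rfl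
  one_mul _ := rfl
  mul_one _ := rfl
  inv_mul_cancel f := ext_total fun p => f.toDiffeo.symm_apply_apply p

/-- The underlying continuous map of the total space. -/
noncomputable def toContinuousMap (f : BundleAut ξ) : C(P, P) :=
  ⟨f.toDiffeo, f.toDiffeo.continuous⟩

/-- The compact-open topology on the automorphism group: the topology induced from `C(P, P)`. -/
noncomputable instance : TopologicalSpace (BundleAut ξ) :=
  TopologicalSpace.induced toContinuousMap inferInstance

end BundleAut

/-- A frame: a continuous homomorphism `γ : ℂ → Aut(P)` such that the induced action of `ℂ` on the
base is transitive. -/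
def IsFrame {ξ : SmoothPrincipalBundle IG IP IS G P S}
    (γ : Multiplicative ℂ →ₜ* BundleAut ξ) : Prop :=
  ∀ b b' : S, ∃ z : ℂ, (γ (Multiplicative.ofAdd z)).baseDiffeo b = b'

end

/-- A smooth surface of genus one: a smooth manifold diffeomorphic to the standard
two-dimensional torus. -/
def IsGenusOneSurface {ES HS : Type*} [NormedAddCommGroup ES] [NormedSpace ℝ ES]
    [TopologicalSpace HS] (IS : ModelWithCorners ℝ ES HS) (S : Type*) [TopologicalSpace S]
    [ChartedSpace HS S] : Prop :=
  IsManifold IS ∞ S ∧ Nonempty (S ≃ₘ⟮IS, (𝓡 1).prod (𝓡 1)⟯ (Circle × Circle))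

/-- A topological group is a torus if it is isomorphic, as a topological group, to a finite power
of the circle group. -/
def IsTorusGroup (T : Type*) [Group T] [TopologicalSpace T] : Prop :=
  ∃ n : ℕ, Nonempty (T ≃ₜ* (Fin n → Circle))

/-! Fix `p₀ : P` and let `Λ ⊆ ℂ` be the stabilizer of `π(p₀)`. The orbit map identifies the base
with `ℂ/Λ`, and since the base is a 2-torus, `Λ` is a lattice (`exists_lattice_basis`). For `l ∈ Λ`
write `γ(l)p₀ = p₀ · h(l)`; this defines the holonomy `h : Λ → G`, and the closure `H` of `h(Λ)` is
a compact abelian group. The map `(w, g) ↦ γ(w)p₀ · g` presents `P` as a quotient of `ℂ × G` by `Λ`,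
with `(w + l, g) ∼ (w, h(l)g)`. As `H` commutes with `h(Λ)`, each `η ∈ H` gives a well-defined twist
`φ_η : γ(w)p₀ · g ↦ γ(w)p₀ · ηg`, which commutes with the flow and with the right action.

Hence `τ(z, η) = γ(z)φ_η` is a homomorphism `ℂ × H → Aut(P)` with kernel `{(l, h(l)⁻¹)}`. Its image
contains `γ(ℂ)`, and it is compact because a compact set of parameters `z` already suffices. It is a
torus because the characters of `ℂ × H` trivial on the kernel are torsion free
(`character_eq_one_of_zpow_eq_one`): a torsion character dies on the divisible group `ℂ`, then on
`h(Λ)` through the kernel, then on `H` by density. Finitely many of these characters cut out the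
kernel (`exists_characters_frameHom`), so a basis of the group they generate gives an isomorphism of
the image with `(S¹)ⁿ` (`isTorusGroup_range`).

The delicate point is that `φ_η` must be smooth, whereas `γ` is only continuous in `z`. For `η =
h(l)` the twist is the diffeomorphism `γ(l)`. For general `η`, take a faithful immersive
representation `ρ` of `G` in finite dimension: `ρ(η)` is a linear combination of operators
`ρ(h(l))`, so the local coordinate of `φ_η`, seen through `ρ`, is a linear combination of smooth
functions (`contMDiff_twist`). Such a `ρ` comes from the Peter–Weyl argument
(`exists_faithful_unitary_rep`): eigenspaces of compact convolution operators on `L²(G)` separate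
points and tangent vectors. -/

open scoped Topology
open MeasureTheory

/-! ### Smooth dependence of integrals on parameters -/

section ParametricIntegral

variable {E : Type*} [NormedAddCommGroup E] [NormedSpace ℝ E]
  {EY HY Y : Type*} [NormedAddCommGroup EY] [NormedSpace ℝ EY] [TopologicalSpace HY]
  {IY : ModelWithCorners ℝ EY HY} [TopologicalSpace Y] [ChartedSpace HY Y]

/-- The partial derivative of a smooth function on an open part of `E × Y` is smooth. -/
theorem ContMDiffOn.partial_fderiv [IsManifold IY ∞ Y] {φ : E → Y → ℂ} {U : Set E} (hU : IsOpen U)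
    (hφ : ContMDiffOn (𝓘(ℝ, E).prod IY) 𝓘(ℝ, ℂ) ∞ (fun q : E × Y => φ q.1 q.2) (U ×ˢ Set.univ)) :
    ContMDiffOn (𝓘(ℝ, E).prod IY) 𝓘(ℝ, E →L[ℝ] ℂ) ∞
      (fun q : E × Y => fderiv ℝ (fun u => φ u q.2) q.1) (U ×ˢ Set.univ) := by
  intro q hq
  have hφq : ContMDiffAt (𝓘(ℝ, E).prod IY) 𝓘(ℝ, ℂ) ∞ (fun q : E × Y => φ q.1 q.2) (q.1, q.2) :=
    (hφ q hq).contMDiffAt ((hU.prod isOpen_univ).mem_nhds hq)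
  have hcomp : ContMDiffAt ((𝓘(ℝ, E).prod IY).prod 𝓘(ℝ, E)) 𝓘(ℝ, ℂ) ∞
      (Function.uncurry fun (n : E × Y) (m : E) => φ m n.2) (q, q.1) :=
    ContMDiffAt.comp (x := (q, q.1)) (f := fun r : (E × Y) × E => (r.2, r.1.2))
      (g := fun q : E × Y => φ q.1 q.2) hφq
      (contMDiffAt_snd.prodMk (contMDiffAt_snd.comp _ contMDiffAt_fst))
  have := ContMDiffAt.mfderiv (fun (n : E × Y) (m : E) => φ m n.2) Prod.fst hcomp
    contMDiffAt_fst (m := ∞) (by simp)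
  refine ContMDiffAt.contMDiffWithinAt ?_
  convert! this using 1
  ext r : 1
  simp [inTangentCoordinates_model_space, mfderiv_eq_fderiv]

variable [CompactSpace Y] [FiniteDimensional ℝ E]

/-- A function that is jointly continuous on `U × Y` with `Y` compact is bounded by a constant
near each point of the open set `U`. -/
theorem exists_bound_of_continuousOn_prod {F : Type*} [NormedAddCommGroup F] {ψ : E × Y → F}
    {U : Set E} (hU : IsOpen U) (hψ : ContinuousOn ψ (U ×ˢ Set.univ)) {u : E} (hu : u ∈ U) :
    ∃ s ∈ 𝓝 u, s ⊆ U ∧ ∃ C : ℝ, ∀ x ∈ s, ∀ y, ‖ψ (x, y)‖ ≤ C := by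
  obtain ⟨s, hs, hsU, hsc⟩ := local_compact_nhds (hU.mem_nhds hu)
  obtain ⟨C, hC⟩ := ((hsc.prod isCompact_univ).image_of_continuousOn
    (hψ.mono (Set.prod_mono hsU le_rfl))).isBounded.exists_norm_le
  exact ⟨s, hs, hsU, C, fun x hx y => hC _ ⟨(x, y), ⟨hx, trivial⟩, rfl⟩⟩

variable [MeasurableSpace Y] [BorelSpace Y] {μ : Measure Y}

theorem integrable_continuous_mul [IsFiniteMeasure μ] {f w : Y → ℂ} (hf : Continuous f)
    (hw : Integrable w μ) : Integrable (fun y => f y * w y) μ := by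
  obtain ⟨C, hC⟩ := (isCompact_range hf).isBounded.exists_norm_le
  exact hw.bdd_mul hf.aestronglyMeasurable
    (Filter.Eventually.of_forall fun y => hC _ (Set.mem_range_self y))

/-- Near `u` the derivative of the integrand is dominated by `C * ‖w y‖`, by compactness of `Y`. The
second clause rewrites each directional derivative as an integral of the original shape, which is
what makes induction on the order of differentiability possible. -/
theorem hasFDerivAt_integral_mul [IsManifold IY ∞ Y] [IsFiniteMeasure μ] {φ : E → Y → ℂ}
    {U : Set E} (hU : IsOpen U)
    (hφ : ContMDiffOn (𝓘(ℝ, E).prod IY) 𝓘(ℝ, ℂ) ∞ (fun q : E × Y => φ q.1 q.2) (U ×ˢ Set.univ))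
    {w : Y → ℂ} (hw : Integrable w μ) {u : E} (hu : u ∈ U) :
    HasFDerivAt (fun u => ∫ y, φ u y * w y ∂μ)
      (∫ y, (ContinuousLinearMap.mul ℝ ℂ).flip (w y) ∘L fderiv ℝ (fun u => φ u y) u ∂μ) u ∧
    ∀ v, (∫ y, (ContinuousLinearMap.mul ℝ ℂ).flip (w y) ∘L fderiv ℝ (fun u => φ u y) u ∂μ) v
      = ∫ y, fderiv ℝ (fun u => φ u y) u v * w y ∂μ := by
  have hφ' := ContMDiffOn.partial_fderiv hU hφ
  have hslice : ∀ x ∈ U, Continuous fun y => φ x y := fun x hx =>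
    hφ.continuousOn.comp_continuous (f := fun y => (x, y)) (by fun_prop) fun y => ⟨hx, trivial⟩
  have hslice' : ∀ x ∈ U, Continuous fun y => fderiv ℝ (fun u => φ u y) x := fun x hx =>
    hφ'.continuousOn.comp_continuous (f := fun y => (x, y)) (by fun_prop) fun y => ⟨hx, trivial⟩
  have hdiff : ∀ x ∈ U, ∀ y, DifferentiableAt ℝ (fun u => φ u y) x := fun x hx y => by
    have h1 : ContMDiffAt (𝓘(ℝ, E).prod IY) 𝓘(ℝ, ℂ) ∞ (fun q : E × Y => φ q.1 q.2) (x, y) :=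
      (hφ (x, y) ⟨hx, trivial⟩).contMDiffAt ((hU.prod isOpen_univ).mem_nhds ⟨hx, trivial⟩)
    have h2 : ContMDiffAt 𝓘(ℝ, E) 𝓘(ℝ, ℂ) ∞ (fun u => φ u y) x :=
      ContMDiffAt.comp (x := x) (f := fun u : E => (u, y)) (g := fun q : E × Y => φ q.1 q.2) h1
        (contMDiffAt_id.prodMk contMDiffAt_const)
    exact (contMDiffAt_iff_contDiffAt.1 h2).differentiableAt (by simp)
  obtain ⟨s, hs, hsU, C, hC⟩ := exists_bound_of_continuousOn_prod hU hφ'.continuousOn hu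
  have hnorm : ∀ x ∈ s, ∀ y, ‖(ContinuousLinearMap.mul ℝ ℂ).flip (w y) ∘L
      fderiv ℝ (fun u => φ u y) x‖ ≤ C * ‖w y‖ := fun x hx y => by
    refine (ContinuousLinearMap.opNorm_comp_le _ _).trans ?_
    rw [mul_comm]
    refine mul_le_mul (hC x hx y) ?_ (norm_nonneg _) ((norm_nonneg _).trans (hC x hx y))
    refine ContinuousLinearMap.opNorm_le_bound _ (norm_nonneg _) fun z => ?_
    simp [mul_comm]
  have hmeas : AEStronglyMeasurable (fun y => (ContinuousLinearMap.mul ℝ ℂ).flip (w y) ∘L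
      fderiv ℝ (fun u => φ u y) u) μ :=
    (ContinuousLinearMap.compL ℝ E ℂ ℂ).aestronglyMeasurable_comp₂
      ((ContinuousLinearMap.mul ℝ ℂ).flip.continuous.comp_aestronglyMeasurable
        hw.aestronglyMeasurable) (hslice' u hu).aestronglyMeasurable
  have hint : Integrable (fun y => (ContinuousLinearMap.mul ℝ ℂ).flip (w y) ∘L
      fderiv ℝ (fun u => φ u y) u) μ :=
    (hw.norm.const_mul C).mono' hmeas
      (Filter.Eventually.of_forall fun y => hnorm u (mem_of_mem_nhds hs) y)
  refine ⟨hasFDerivAt_integral_of_dominated_of_fderiv_le (𝕜 := ℝ) (bound := fun y => C * ‖w y‖)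
      (F' := fun x y => (ContinuousLinearMap.mul ℝ ℂ).flip (w y) ∘L fderiv ℝ (fun u => φ u y) x)
      hs ?_ (integrable_continuous_mul (hslice u hu) hw) hmeas
      (Filter.Eventually.of_forall fun y x hx => hnorm x hx y) (hw.norm.const_mul C)
      (Filter.Eventually.of_forall fun y x hx => ?_), fun v => ?_⟩
  · filter_upwards [hU.mem_nhds hu] with x hx
    exact (integrable_continuous_mul (hslice x hx) hw).aestronglyMeasurable
  · exact ((ContinuousLinearMap.mul ℝ ℂ).flip (w y)).hasFDerivAt.comp x
      (hdiff x (hsU hx) y).hasFDerivAt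
  · rw [ContinuousLinearMap.integral_apply hint]
    simp [mul_comm]

/-- The induction varies `φ`: a directional derivative of the integral is the same integral with `φ`
replaced by its partial derivative, again jointly smooth. -/
theorem contDiffOn_integral_mul [IsManifold IY ∞ Y] [IsFiniteMeasure μ] {U : Set E}
    (hU : IsOpen U) {w : Y → ℂ} (hw : Integrable w μ) (n : ℕ) {φ : E → Y → ℂ}
    (hφ : ContMDiffOn (𝓘(ℝ, E).prod IY) 𝓘(ℝ, ℂ) ∞ (fun q : E × Y => φ q.1 q.2)
      (U ×ˢ Set.univ)) :
    ContDiffOn ℝ n (fun u => ∫ y, φ u y * w y ∂μ) U := by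
  induction n generalizing φ with
  | zero =>
    exact contDiffOn_zero.2 fun u hu =>
      (hasFDerivAt_integral_mul hU hφ hw hu).1.continuousAt.continuousWithinAt
  | succ n ih =>
    push_cast
    rw [contDiffOn_succ_iff_fderiv_of_isOpen hU]
    refine ⟨fun u hu =>
        (hasFDerivAt_integral_mul hU hφ hw hu).1.differentiableAt.differentiableWithinAt,
      by simp, contDiffOn_clm_apply.2 fun v => ?_⟩
    have hv : ContMDiffOn (𝓘(ℝ, E).prod IY) 𝓘(ℝ, ℂ) ∞
        (fun q : E × Y => fderiv ℝ (fun u => φ u q.2) q.1 v) (U ×ˢ Set.univ) :=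
      (ContMDiffOn.partial_fderiv hU hφ).clm_apply contMDiffOn_const
    refine (ih (φ := fun x y => fderiv ℝ (fun u => φ u y) x v) hv).congr fun u hu => ?_
    obtain ⟨h1, h2⟩ := hasFDerivAt_integral_mul hU hφ hw hu
    rw [h1.fderiv, h2]

variable {HM M : Type*} [TopologicalSpace HM] {IM : ModelWithCorners ℝ E HM} [IM.Boundaryless]
  [TopologicalSpace M] [ChartedSpace HM M]

/-- Integrating a smooth function of two variables against an integrable weight in the second,
compact, variable gives a smooth function of the first variable. -/
theorem contMDiff_integral_mul [IsManifold IM ∞ M] [IsManifold IY ∞ Y] [IsFiniteMeasure μ]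
    {Φ : M → Y → ℂ}
    (hΦ : ContMDiff (IM.prod IY) 𝓘(ℝ, ℂ) ∞ (fun q : M × Y => Φ q.1 q.2))
    {w : Y → ℂ} (hw : Integrable w μ) :
    ContMDiff IM 𝓘(ℝ, ℂ) ∞ (fun x => ∫ y, Φ x y * w y ∂μ) := by
  intro x
  have hU : IsOpen (extChartAt IM x).target := isOpen_extChartAt_target x
  have hφ : ContMDiffOn (𝓘(ℝ, E).prod IY) 𝓘(ℝ, ℂ) ∞
      (fun q : E × Y => Φ ((extChartAt IM x).symm q.1) q.2)
      ((extChartAt IM x).target ×ˢ Set.univ) := by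
    refine hΦ.comp_contMDiffOn (ContMDiffOn.prodMk
      ((contMDiffOn_extChartAt_symm x).comp contMDiffOn_fst fun q hq => hq.1) contMDiffOn_snd)
  have h : ContDiffOn ℝ ∞ (fun u => ∫ y, Φ ((extChartAt IM x).symm u) y * w y ∂μ)
      (extChartAt IM x).target :=
    contDiffOn_infty.2 fun n => contDiffOn_integral_mul hU hw n hφ
  have h2 := (contMDiffOn_iff_contDiffOn.2 h).comp (contMDiffOn_extChartAt (I := IM) (x := x))
    fun y hy => (extChartAt IM x).map_source (by simpa using hy)
  refine ((h2.congr fun y hy => ?_).contMDiffAt ?_)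
  · simp only [Function.comp]
    rw [(extChartAt IM x).left_inv (by simpa using hy)]
  · exact (chartAt HM x).open_source.mem_nhds (mem_chart_source HM x)

end ParametricIntegral

/-! ### Compactness of integral operators -/

section InnerOperator

variable {X 𝓗 : Type*} [TopologicalSpace X] [CompactSpace X]
  [NormedAddCommGroup 𝓗] [InnerProductSpace ℂ 𝓗]

/-- The operator sending a vector `f` to the function `x ↦ ⟪κ x, f⟫`. -/
noncomputable def innerOperator (κ : C(X, 𝓗)) : 𝓗 →L[ℂ] C(X, ℂ) :=
  LinearMap.mkContinuous
    { toFun := fun f => ⟨fun x => inner ℂ (κ x) f, by fun_prop⟩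
      map_add' := fun f g => by ext x; simp
      map_smul' := fun c f => by ext x; simp }
    ‖κ‖ fun f => by
      rw [ContinuousMap.norm_le _ (by positivity)]
      intro x
      exact (norm_inner_le_norm _ _).trans
        (mul_le_mul_of_nonneg_right (κ.norm_coe_le_norm x) (norm_nonneg _))

@[simp]
theorem innerOperator_apply (κ : C(X, 𝓗)) (f : 𝓗) (x : X) :
    innerOperator κ f x = inner ℂ (κ x) f := rfl

/-- Arzelà–Ascoli: for `‖f‖ ≤ 1` the image functions satisfy `|⟪κ x - κ y, f⟫| ≤ ‖κ x - κ y‖`, a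
modulus of continuity independent of `f`. -/
theorem isCompactOperator_innerOperator (κ : C(X, 𝓗)) : IsCompactOperator (innerOperator κ) := by
  refine (isCompactOperator_iff_isCompact_closure_image_closedBall (innerOperator κ).toLinearMap
    zero_lt_one).2 ?_
  let e : C(X, ℂ) ≃ᵢ (BoundedContinuousFunction X ℂ) :=
    ContinuousMap.isometryEquivBoundedOfCompact X ℂ
  have key : IsCompact (closure (e '' (innerOperator κ '' Metric.closedBall 0 1))) := by
    refine BoundedContinuousFunction.arzela_ascoli (Metric.closedBall 0 ‖innerOperator κ‖)
      (isCompact_closedBall _ _) _ ?_ ?_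
    · rintro _ x ⟨_, ⟨f, hf, rfl⟩, rfl⟩
      rw [mem_closedBall_zero_iff] at hf ⊢
      calc ‖innerOperator κ f x‖ ≤ ‖innerOperator κ f‖ := ContinuousMap.norm_coe_le_norm _ _
        _ ≤ ‖innerOperator κ‖ * ‖f‖ := ContinuousLinearMap.le_opNorm _ _
        _ ≤ ‖innerOperator κ‖ := mul_le_of_le_one_right (norm_nonneg _) hf
    · intro x
      rw [Metric.equicontinuousAt_iff_right]
      intro ε hε
      have := Metric.continuousAt_iff'.1 (κ.continuous.continuousAt (x := x)) ε hε
      filter_upwards [this] with y hy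
      rintro ⟨_, _, ⟨f, hf, rfl⟩, rfl⟩
      rw [mem_closedBall_zero_iff] at hf
      change dist (innerOperator κ f x) (innerOperator κ f y) < ε
      rw [dist_comm, dist_eq_norm, innerOperator_apply, innerOperator_apply, ← inner_sub_left]
      refine (norm_inner_le_norm _ _).trans_lt (lt_of_le_of_lt ?_ hy)
      rw [dist_eq_norm]
      exact mul_le_of_le_one_right (norm_nonneg _) hf
  have h := key.image e.symm.toHomeomorph.continuous
  rwa [e.symm.toHomeomorph.image_closure, ← Set.image_comp,
    show (⇑e.symm.toHomeomorph ∘ ⇑e) = id from funext fun x => e.symm_apply_apply x,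
    Set.image_id] at h

end InnerOperator

/-! ### Left translation and convolution on `L²(G)` -/

section LeftTranslation

variable {G : Type*} [TopologicalSpace G] [Group G] [IsTopologicalGroup G]
  [MeasurableSpace G] [BorelSpace G] (μ : Measure G)

section Kernel

variable [CompactSpace G] [IsFiniteMeasure μ]

/-- The family of left translates of `k`, as a map to `L²(G)`. -/
noncomputable def translateKernel (k : C(G, ℂ)) : C(G, Lp ℂ 2 μ) :=
  ContinuousMap.comp ⟨ContinuousMap.toLp 2 μ ℂ, ContinuousLinearMap.continuous _⟩
    (ContinuousMap.curry ⟨fun q : G × G => k (q.1⁻¹ * q.2), by fun_prop⟩)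

theorem translateKernel_apply (k : C(G, ℂ)) (x : G) :
    translateKernel μ k x =
      ContinuousMap.toLp 2 μ ℂ (k.comp ⟨fun y => x⁻¹ * y, by fun_prop⟩) := rfl

/-- Convolution with the kernel `k`, as an operator on `L²(G)`. -/
noncomputable def convolutionOperator (k : C(G, ℂ)) : Lp ℂ 2 μ →L[ℂ] Lp ℂ 2 μ :=
  (ContinuousMap.toLp 2 μ ℂ) ∘L innerOperator (translateKernel μ k)

theorem isCompactOperator_convolutionOperator (k : C(G, ℂ)) :
    IsCompactOperator (convolutionOperator μ k) :=
  (isCompactOperator_innerOperator (translateKernel μ k)).clm_comp (ContinuousMap.toLp 2 μ ℂ)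

end Kernel

section Translation

variable [μ.IsMulLeftInvariant]

/-- Left translation on `L²(G)`. -/
noncomputable def leftTranslate (g : G) : Lp ℂ 2 μ →ₗᵢ[ℂ] Lp ℂ 2 μ :=
  Lp.compMeasurePreservingₗᵢ ℂ (fun x => g⁻¹ * x) (measurePreserving_mul_left μ g⁻¹)

theorem coeFn_leftTranslate (g : G) (f : Lp ℂ 2 μ) :
    leftTranslate μ g f =ᵐ[μ] fun x => f (g⁻¹ * x) :=
  Lp.coeFn_compMeasurePreserving f (measurePreserving_mul_left μ g⁻¹)

@[simp]
theorem leftTranslate_one (f : Lp ℂ 2 μ) : leftTranslate μ 1 f = f := by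
  refine Lp.ext ?_
  filter_upwards [coeFn_leftTranslate μ 1 f] with x hx
  simpa using hx

theorem leftTranslate_mul (g h : G) (f : Lp ℂ 2 μ) :
    leftTranslate μ (g * h) f = leftTranslate μ g (leftTranslate μ h f) := by
  refine Lp.ext ?_
  have h1 := (measurePreserving_mul_left μ g⁻¹).quasiMeasurePreserving.ae_eq_comp
    (coeFn_leftTranslate μ h f)
  filter_upwards [coeFn_leftTranslate μ (g * h) f, coeFn_leftTranslate μ g (leftTranslate μ h f),
    h1] with x h2 h3 h4
  rw [h2, h3]
  simp only [Function.comp] at h4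
  rw [h4]
  group

theorem inner_leftTranslate_right (g : G) (u f : Lp ℂ 2 μ) :
    inner ℂ u (leftTranslate μ g f) = inner ℂ (leftTranslate μ g⁻¹ u) f := by
  have h := (leftTranslate μ g).inner_map_map (leftTranslate μ g⁻¹ u) f
  rwa [← leftTranslate_mul, mul_inv_cancel, leftTranslate_one] at h

variable [CompactSpace G] [IsFiniteMeasure μ]

theorem leftTranslate_toLp (g : G) (F : C(G, ℂ)) :
    leftTranslate μ g (ContinuousMap.toLp 2 μ ℂ F) =
      ContinuousMap.toLp 2 μ ℂ (F.comp ⟨fun x => g⁻¹ * x, by fun_prop⟩) := by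
  refine Lp.ext ?_
  have h1 := (measurePreserving_mul_left μ g⁻¹).quasiMeasurePreserving.ae_eq_comp
    (ContinuousMap.coeFn_toLp (p := 2) μ (𝕜 := ℂ) F)
  filter_upwards [coeFn_leftTranslate μ g (ContinuousMap.toLp 2 μ ℂ F), h1,
    ContinuousMap.coeFn_toLp (p := 2) μ (𝕜 := ℂ) (F.comp ⟨fun x => g⁻¹ * x, by fun_prop⟩)]
    with x h2 h3 h4
  rw [h2, h4]
  exact h3

theorem leftTranslate_translateKernel (k : C(G, ℂ)) (g x : G) :
    leftTranslate μ g (translateKernel μ k x) = translateKernel μ k (g * x) := by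
  rw [translateKernel_apply, leftTranslate_toLp, translateKernel_apply]
  congr 1
  ext y
  simp [mul_assoc]

/-- The kernel `k (x⁻¹ * y)` is unchanged when `x` and `y` are translated simultaneously on the
left. -/
theorem convolutionOperator_leftTranslate (k : C(G, ℂ)) (g : G) (f : Lp ℂ 2 μ) :
    convolutionOperator μ k (leftTranslate μ g f) =
      leftTranslate μ g (convolutionOperator μ k f) := by
  simp only [convolutionOperator, ContinuousLinearMap.comp_apply, leftTranslate_toLp]
  congr 1
  ext x
  simp only [innerOperator_apply, inner_leftTranslate_right, leftTranslate_translateKernel]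
  rfl

end Translation

end LeftTranslation

/-! ### Peter–Weyl: smooth subrepresentations separate points -/

theorem inner_eq_integral_mul {α : Type*} [MeasurableSpace α] {μ : Measure α} (f u : Lp ℂ 2 μ) :
    inner ℂ f u = ∫ y, u y * (starRingEnd ℂ) (f y) ∂μ := by
  rw [L2.inner_def]
  rfl

section SmoothSubrep

variable {EG HG : Type*} [NormedAddCommGroup EG] [NormedSpace ℝ EG] [TopologicalSpace HG]
  (IG : ModelWithCorners ℝ EG HG)
  {G : Type*} [TopologicalSpace G] [ChartedSpace HG G] [Group G] [IsTopologicalGroup G]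
  [MeasurableSpace G] [BorelSpace G] (μ : Measure G) [μ.IsMulLeftInvariant]

/-- A finite-dimensional left-invariant subspace of `L²(G)` with smooth matrix coefficients. -/
structure IsSmoothSubrep (W : Submodule ℂ (Lp ℂ 2 μ)) : Prop where
  finiteDimensional : FiniteDimensional ℂ W
  invariant : ∀ g : G, ∀ f ∈ W, leftTranslate μ g f ∈ W
  smooth : ∀ w : Lp ℂ 2 μ, ∀ f ∈ W,
    ContMDiff IG 𝓘(ℝ, ℂ) ∞ fun g => inner ℂ w (leftTranslate μ g f)

variable {IG μ}

theorem IsSmoothSubrep.bot : IsSmoothSubrep IG μ ⊥ where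
  finiteDimensional := inferInstance
  invariant g f hf := by simp_all
  smooth w f hf := by
    rw [Submodule.mem_bot] at hf
    simpa [hf] using contMDiff_const

theorem IsSmoothSubrep.sup {W W' : Submodule ℂ (Lp ℂ 2 μ)} (hW : IsSmoothSubrep IG μ W)
    (hW' : IsSmoothSubrep IG μ W') : IsSmoothSubrep IG μ (W ⊔ W') where
  finiteDimensional := by
    have := hW.finiteDimensional
    have := hW'.finiteDimensional
    infer_instance
  invariant g f hf := by
    obtain ⟨a, ha, b, hb, rfl⟩ := Submodule.mem_sup.1 hf
    rw [map_add]
    exact Submodule.add_mem_sup (hW.invariant g a ha) (hW'.invariant g b hb)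
  smooth w f hf := by
    obtain ⟨a, ha, b, hb, rfl⟩ := Submodule.mem_sup.1 hf
    simp only [map_add, inner_add_right]
    exact (hW.smooth w a ha).add (hW'.smooth w b hb)

variable [CompactSpace G] [IsFiniteMeasure μ]

theorem adjoint_convolutionOperator_leftTranslate (k : C(G, ℂ)) (g : G) (f : Lp ℂ 2 μ) :
    (ContinuousLinearMap.adjoint (convolutionOperator μ k)) (leftTranslate μ g f) =
      leftTranslate μ g ((ContinuousLinearMap.adjoint (convolutionOperator μ k)) f) := by
  refine ext_inner_left ℂ fun u => ?_
  rw [ContinuousLinearMap.adjoint_inner_right, inner_leftTranslate_right,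
    inner_leftTranslate_right, ContinuousLinearMap.adjoint_inner_right,
    convolutionOperator_leftTranslate]

variable [FiniteDimensional ℝ EG] [IG.Boundaryless] [LieGroup IG ∞ G]

theorem contMDiff_innerOperator_translateKernel (k : C(G, ℂ)) (hk : ContMDiff IG 𝓘(ℝ, ℂ) ∞ k)
    (u : Lp ℂ 2 μ) : ContMDiff IG 𝓘(ℝ, ℂ) ∞ (innerOperator (translateKernel μ k) u) := by
  have h : ∀ x, innerOperator (translateKernel μ k) u x =
      ∫ y, (starRingEnd ℂ) (k (x⁻¹ * y)) * u y ∂μ := fun x => by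
    rw [innerOperator_apply, inner_eq_integral_mul]
    refine integral_congr_ae ?_
    filter_upwards [ContinuousMap.coeFn_toLp (p := 2) μ (𝕜 := ℂ)
      (k.comp ⟨fun y => x⁻¹ * y, by fun_prop⟩)] with y hy
    rw [translateKernel_apply, hy, mul_comm]
    rfl
  have h2 := contMDiff_integral_mul (μ := μ) (IM := IG) (IY := IG)
    (Φ := fun x y => (starRingEnd ℂ) (k (x⁻¹ * y))) (w := u) ?_
    ((Lp.memLp u).integrable (by norm_num))
  · exact (funext h : _ = _) ▸ h2
  · have hc : ContMDiff 𝓘(ℝ, ℂ) 𝓘(ℝ, ℂ) ∞ (starRingEnd ℂ) :=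
      Complex.conjCLE.contDiff.contMDiff
    refine hc.comp (hk.comp ((contMDiff_fst.inv).mul contMDiff_snd))

/-- Compactness gives finite dimension and commutation with translations gives invariance.
Smoothness holds because an eigenvector for `c ≠ 0` is `c⁻¹` times a convolution with `k`, hence is
represented by a smooth function. -/
theorem isSmoothSubrep_eigenspace (k : C(G, ℂ)) (hk : ContMDiff IG 𝓘(ℝ, ℂ) ∞ k) {c : ℂ}
    (hc : c ≠ 0) :
    IsSmoothSubrep IG μ (Module.End.eigenspace ((convolutionOperator μ k ∘L
      ContinuousLinearMap.adjoint (convolutionOperator μ k) : Lp ℂ 2 μ →L[ℂ] Lp ℂ 2 μ) :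
        Module.End ℂ (Lp ℂ 2 μ)) c) where
  finiteDimensional := ContinuousLinearMap.finite_dimensional_eigenspace
    ((isCompactOperator_convolutionOperator μ k).comp_clm _) c hc
  invariant g f hf := by
    rw [Module.End.mem_eigenspace_iff] at hf ⊢
    simp only [ContinuousLinearMap.coe_coe, ContinuousLinearMap.comp_apply] at hf ⊢
    rw [adjoint_convolutionOperator_leftTranslate, convolutionOperator_leftTranslate, hf, map_smul]
  smooth w f hf := by
    rw [Module.End.mem_eigenspace_iff] at hf
    simp only [ContinuousLinearMap.coe_coe, ContinuousLinearMap.comp_apply] at hf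
    set u := (ContinuousLinearMap.adjoint (convolutionOperator μ k)) f
    have hf' : f = c⁻¹ • convolutionOperator μ k u := by
      rw [hf, smul_smul, inv_mul_cancel₀ hc, one_smul]
    set F := innerOperator (translateKernel μ k) u with hF
    have hFs : ContMDiff IG 𝓘(ℝ, ℂ) ∞ F := contMDiff_innerOperator_translateKernel k hk u
    have h : ∀ g, inner ℂ w (leftTranslate μ g f) =
        c⁻¹ * ∫ y, F (g⁻¹ * y) * (starRingEnd ℂ) (w y) ∂μ := fun g => by
      rw [hf', map_smul, inner_smul_right, inner_eq_integral_mul]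
      congr 1
      change ∫ y, (leftTranslate μ g (ContinuousMap.toLp 2 μ ℂ F)) y * _ ∂μ = _
      rw [leftTranslate_toLp]
      refine integral_congr_ae ?_
      filter_upwards [ContinuousMap.coeFn_toLp (p := 2) μ (𝕜 := ℂ)
        (F.comp ⟨fun y => g⁻¹ * y, by fun_prop⟩)] with y hy
      rw [hy]
      rfl
    simp only [h]
    have hw : Integrable (fun y => (starRingEnd ℂ) (w y)) μ :=
      Complex.conjCLE.toContinuousLinearMap.integrable_comp
        ((Lp.memLp w).integrable (by norm_num))
    exact (ContinuousLinearMap.mul ℝ ℂ c⁻¹).contDiff.contMDiff.comp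
      (contMDiff_integral_mul (IM := IG) (IY := IG) (Φ := fun g y => F (g⁻¹ * y))
        (hFs.comp ((contMDiff_fst.inv).mul contMDiff_snd)) hw)

/-- Smooth finite-dimensional subrepresentations of `L²(G)` separate the points of `G`. -/
theorem exists_isSmoothSubrep_ne [T2Space G] [μ.IsOpenPosMeasure] {g : G} (hg : g ≠ 1) :
    ∃ W, IsSmoothSubrep IG μ W ∧ ∃ f ∈ W, leftTranslate μ g f ≠ f := by
  by_contra! hcon
  -- The kernel is a smooth function with `ψ g = 0` and `ψ 1 = 1`; the argument below would force
  -- these values to agree.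
  obtain ⟨ψ, hψ0, hψ1, -⟩ := exists_contMDiffMap_zero_one_of_isClosed (n := ⊤) IG
    (isClosed_singleton (x := g)) (isClosed_singleton (x := (1 : G))) (by simpa using hg)
  have hkc : ContMDiff IG 𝓘(ℝ, ℂ) ∞ fun x => (ψ x : ℂ) :=
    (Complex.ofRealCLM.contDiff.contMDiff).comp ψ.contMDiff
  let k : C(G, ℂ) := ⟨fun x => (ψ x : ℂ), hkc.continuous⟩
  set C := convolutionOperator μ k with hC
  set T := C ∘L ContinuousLinearMap.adjoint C with hT
  have hTc : IsCompactOperator T := (isCompactOperator_convolutionOperator μ k).comp_clm _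
  have hTs : T.IsSymmetric := fun x y => by
    simp [hT, ← ContinuousLinearMap.adjoint_inner_right]
  let D : Lp ℂ 2 μ →L[ℂ] Lp ℂ 2 μ := (leftTranslate μ g).toContinuousLinearMap - 1
  -- By assumption translation by `g` fixes every eigenvector of `T` with nonzero eigenvalue, and
  -- `T` kills the rest; the eigenspaces of the compact symmetric operator `T` span a dense
  -- subspace.
  have hDT : D ∘L T = 0 := by
    have hdense : (⨆ c, Module.End.eigenspace (T : Module.End ℂ (Lp ℂ 2 μ)) c).topologicalClosure
        = ⊤ := by
      rw [Submodule.topologicalClosure_eq_top_iff]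
      exact ContinuousLinearMap.orthogonalComplement_iSup_eigenspaces_eq_bot hTc hTs
    have hle : (⨆ c, Module.End.eigenspace (T : Module.End ℂ (Lp ℂ 2 μ)) c) ≤
        LinearMap.ker (D ∘L T : Lp ℂ 2 μ →L[ℂ] Lp ℂ 2 μ).toLinearMap := by
      refine iSup_le fun c f hf => ?_
      have hf' : T f = c • f := Module.End.mem_eigenspace_iff.1 hf
      rw [LinearMap.mem_ker]
      change D (T f) = 0
      rw [hf']
      by_cases hc : c = 0
      · simp [hc]
      · have := hcon _ (isSmoothSubrep_eigenspace k hkc hc) f hf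
        simp [D, this]
    have hcl := Submodule.topologicalClosure_minimal _ hle (D ∘L T).isClosed_ker
    ext1 f
    have : f ∈ (⊤ : Submodule ℂ (Lp ℂ 2 μ)) := trivial
    rw [← hdense] at this
    exact hcl this
  -- The C*-identity removes the adjoint: `(DC)(DC)* = (D C C*) D* = 0`.
  have hDC : D * C = 0 := by
    rw [← CStarRing.mul_star_self_eq_zero_iff, star_mul, ← mul_assoc, mul_assoc D]
    have : D * (C * star C) = 0 := hDT
    rw [this, zero_mul]
  -- Every `C u` is now invariant under `g`. Comparing its continuous representative at `g` and at
  -- `1` identifies the two kernel vectors, whence `k` is itself invariant and `k g = k 1`.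
  have hκ : translateKernel μ k 1 = translateKernel μ k g := by
    refine ext_inner_right ℂ fun u => ?_
    have h1 : D (C u) = 0 := congrArg (fun A : Lp ℂ 2 μ →L[ℂ] Lp ℂ 2 μ => A u) hDC
    have h2 : leftTranslate μ g (C u) = C u := sub_eq_zero.1 h1
    have h3 := ContinuousMap.toLp_injective (p := 2) (𝕜 := ℂ) μ
      ((leftTranslate_toLp μ g (innerOperator (translateKernel μ k) u)).symm.trans h2)
    have h4 := DFunLike.congr_fun h3 g
    simpa using h4
  have h5 := ContinuousMap.toLp_injective (p := 2) (𝕜 := ℂ) μ hκ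
  have h6 := DFunLike.congr_fun h5 g
  have h0 : ψ g = 0 := hψ0 rfl
  have h1 : ψ 1 = 1 := hψ1 rfl
  simp [k, h0, h1] at h6

end SmoothSubrep

/-! ### Smooth local left inverses of immersions -/

section LeftInverse

variable {E HM M F : Type*} [NormedAddCommGroup E] [NormedSpace ℝ E] [FiniteDimensional ℝ E]
  [TopologicalSpace HM] {IM : ModelWithCorners ℝ E HM} [IM.Boundaryless]
  [TopologicalSpace M] [ChartedSpace HM M] [IsManifold IM ∞ M]
  [NormedAddCommGroup F] [NormedSpace ℝ F] [FiniteDimensional ℝ F]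

/-- A smooth map to a vector space with injective derivative at `x` has a smooth left inverse
near `x`. -/
theorem exists_contMDiffAt_leftInverse {f : M → F} {x : M} (hf : ContMDiff IM 𝓘(ℝ, F) ∞ f)
    (hinj : Function.Injective (mfderiv IM 𝓘(ℝ, F) f x)) :
    ∃ r : F → M, ContMDiffAt 𝓘(ℝ, F) IM ∞ r (f x) ∧ ∀ᶠ y in 𝓝 x, r (f y) = y := by
  set e := extChartAt IM x
  have htarget : e.target ∈ 𝓝 (e x) := extChartAt_target_mem_nhds x
  have hF1 : ContDiffAt ℝ ∞ (f ∘ e.symm) (e x) := by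
    have := (hf.comp_contMDiffOn (contMDiffOn_extChartAt_symm x)).contMDiffAt htarget
    exact contMDiffAt_iff_contDiffAt.1 this
  have hmf : mfderiv IM 𝓘(ℝ, F) f x = fderiv ℝ (f ∘ e.symm) (e x) := by
    rw [(hf.mdifferentiableAt (by simp)).mfderiv]
    rw [IM.range_eq_univ, fderivWithin_univ]
    rfl
  obtain ⟨L, hL⟩ := LinearMap.exists_leftInverse_of_injective
    (fderiv ℝ (f ∘ e.symm) (e x)).toLinearMap
    (LinearMap.ker_eq_bot.2 (by rw [hmf] at hinj; exact hinj))
  let Lc : F →L[ℝ] E := LinearMap.toContinuousLinearMap L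
  have hh : ContDiffAt ℝ ∞ (Lc ∘ f ∘ e.symm) (e x) := Lc.contDiff.contDiffAt.comp _ hF1
  -- Composing with a linear left inverse of the derivative makes the derivative the identity, so
  -- the inverse function theorem applies in the chart.
  have hh' : HasFDerivAt (Lc ∘ f ∘ e.symm)
      ((ContinuousLinearEquiv.refl ℝ E : E ≃L[ℝ] E) : E →L[ℝ] E) (e x) := by
    have h1 := Lc.hasFDerivAt.comp (e x) (hF1.differentiableAt (by simp)).hasFDerivAt
    convert! h1 using 1
    ext v
    exact (LinearMap.congr_fun hL v).symm
  have hn : (∞ : ℕ∞ω) ≠ 0 := by simp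
  have hinv := hh.to_localInverse hh' hn
  have hstrict := hh.hasStrictFDerivAt' hh' hn
  have hval : hh.localInverse hh' hn ((Lc ∘ f ∘ e.symm) (e x)) = e x :=
    hstrict.localInverse_apply_image
  have hex : e.symm (e x) = x := extChartAt_to_inv x
  have hpt : (Lc ∘ f ∘ e.symm) (e x) = Lc (f x) := by simp [hex]
  refine ⟨fun z => e.symm (hh.localInverse hh' hn (Lc z)), ?_, ?_⟩
  · rw [hpt] at hinv hval
    have h1 : ContMDiffAt 𝓘(ℝ, F) 𝓘(ℝ, E) ∞ (fun z => hh.localInverse hh' hn (Lc z)) (f x) :=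
      contMDiffAt_iff_contDiffAt.2 (hinv.comp (f x) Lc.contDiff.contDiffAt)
    refine ContMDiffAt.comp (x := f x) (g := e.symm) ?_ h1
    rw [hval]
    exact (contMDiffOn_extChartAt_symm x).contMDiffAt htarget
  · have h1 := hstrict.eventually_left_inverse
    have h2 := (continuousAt_extChartAt (I := IM) x).eventually h1
    filter_upwards [h2, extChartAt_source_mem_nhds (I := IM) x] with y hy hys
    have hy2 : e.symm (e y) = y := e.left_inv hys
    change hh.localInverse hh' hn (Lc (f (e.symm (e y)))) = e y at hy
    rw [hy2] at hy
    rw [hy, hy2]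

end LeftInverse

/-! ### Subrepresentations separate tangent vectors -/

section Infinitesimal

variable {EG HG : Type*} [NormedAddCommGroup EG] [NormedSpace ℝ EG] [TopologicalSpace HG]
  (IG : ModelWithCorners ℝ EG HG)
  {G : Type*} [TopologicalSpace G] [ChartedSpace HG G] [Group G] [IsTopologicalGroup G]
  [MeasurableSpace G] [BorelSpace G] (μ : Measure G) [μ.IsMulLeftInvariant]

/-- The tangent vectors at the identity that annihilate all matrix coefficients of `W`. -/
noncomputable def infinitesimalKernel (W : Submodule ℂ (Lp ℂ 2 μ)) :
    Submodule ℝ (GroupLieAlgebra IG G) where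
  carrier := {v | ∀ w : Lp ℂ 2 μ, ∀ f ∈ W,
    mfderiv IG 𝓘(ℝ, ℂ) (fun g => inner ℂ w (leftTranslate μ g f)) (1 : G) v = 0}
  add_mem' {a b} ha hb w f hf := by rw [map_add, ha w f hf, hb w f hf, add_zero]
  zero_mem' w f hf := map_zero _
  smul_mem' c a ha w f hf := by rw [map_smul, ha w f hf, smul_zero]

variable {IG μ}

theorem infinitesimalKernel_anti {W W' : Submodule ℂ (Lp ℂ 2 μ)} (h : W ≤ W') :
    infinitesimalKernel IG μ W' ≤ infinitesimalKernel IG μ W :=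
  fun _ hv w f hf => hv w f (h hf)

variable [CompactSpace G] [IsFiniteMeasure μ] [FiniteDimensional ℝ EG] [IG.Boundaryless]
  [LieGroup IG ∞ G] [T2Space G] [μ.IsOpenPosMeasure]

/-- A tangent vector annihilated by all smooth subrepresentations vanishes: its integral curve
is contained in the common kernel. -/
theorem eq_zero_of_forall_mem_infinitesimalKernel {v : GroupLieAlgebra IG G}
    (hv : ∀ W, IsSmoothSubrep IG μ W → v ∈ infinitesimalKernel IG μ W) : v = 0 := by
  have : LieGroup IG (minSmoothness ℝ 3) G :=
    LieGroup.of_le (n := ∞) (by rw [minSmoothness_of_isRCLikeNormedField]; exact ENat.LEInfty.out)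
  have : IsManifold IG 1 G := IsManifold.of_le (n := ∞) (by simp)
  obtain ⟨c, hc0, hc⟩ := exists_isMIntegralCurveAt_of_contMDiffAt_boundaryless (I := IG) 0
    (v := mulInvariantVectorField v) (x₀ := (1 : G))
    ((contMDiffAt_mulInvariantVectorField v).of_le (by simp))
  obtain ⟨ε, hε, hball⟩ := Metric.eventually_nhds_iff_ball.1 hc
  -- If the curve left `1`, some coefficient would change along it; but all coefficients have zero
  -- derivative along the curve.
  have hconst : ∀ t ∈ Metric.ball (0 : ℝ) ε, c t = 1 := by
    intro t ht
    by_contra hne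
    obtain ⟨W, hW, f, hf, hfne⟩ := exists_isSmoothSubrep_ne (IG := IG) (μ := μ) hne
    refine hfne (ext_inner_left ℂ fun w => ?_)
    let φ : Lp ℂ 2 μ → G → ℂ := fun w g => inner ℂ w (leftTranslate μ g f)
    have hφ : ∀ w, ContMDiff IG 𝓘(ℝ, ℂ) ∞ (φ w) := fun w => hW.smooth w f hf
    have hderiv : ∀ s ∈ Metric.ball (0 : ℝ) ε, HasDerivAt (φ w ∘ c) 0 s := by
      intro s hs
      have h1 := ((hφ w).mdifferentiableAt (x := c s) (by simp)).hasMFDerivAt.comp s (hball s hs)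
      have h2 : mfderiv IG 𝓘(ℝ, ℂ) (φ w) (c s) (mulInvariantVectorField v (c s)) = 0 := by
        -- Left invariance of the field moves the derivative from `c s` to `1`, at the price of
        -- replacing `w` by a translate; `v` annihilates all coefficients at `1`.
        have h3 : φ w ∘ (fun x => c s * x) = φ (leftTranslate μ (c s)⁻¹ w) := by
          ext x
          simp only [φ, Function.comp, leftTranslate_mul]
          rw [inner_leftTranslate_right]
        have h4 : mfderiv IG 𝓘(ℝ, ℂ) (φ w ∘ (fun x => c s * x)) 1 v = 0 := by
          rw [h3]
          exact hv W hW _ f hf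
        rw [mfderiv_comp_of_eq (I' := IG) (y := c s) ((hφ w).mdifferentiableAt (by simp))
          ((contMDiff_mul_left (I := IG) (n := ∞)).mdifferentiableAt (by simp)) (mul_one _)] at h4
        -- The points `c s * 1` and `c s` are only propositionally equal, so the vanishing is
        -- transported through a variable point.
        have hpt : ∀ y : G, y = c s → ∀ A : EG, (mfderiv IG 𝓘(ℝ, ℂ) (φ w) y : EG →L[ℝ] ℂ) A = 0 →
            (mfderiv IG 𝓘(ℝ, ℂ) (φ w) (c s) : EG →L[ℝ] ℂ) A = 0 := by
          rintro y rfl A hA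
          exact hA
        exact hpt _ (mul_one _) _ h4
      obtain ⟨B, hB, hB1⟩ : ∃ B : ℝ →L[ℝ] ℂ, HasFDerivAt (φ w ∘ c) B s ∧ B 1 = 0 := by
        refine ⟨(mfderiv IG 𝓘(ℝ, ℂ) (φ w) (c s) : EG →L[ℝ] ℂ).comp
          ((1 : ℝ →L[ℝ] ℝ).smulRight (mulInvariantVectorField v (c s) : EG)),
          hasMFDerivAt_iff_hasFDerivAt.1 h1, ?_⟩
        have key : ∀ (A : EG →L[ℝ] ℂ) (X : EG), A X = 0 →
            (A.comp ((1 : ℝ →L[ℝ] ℝ).smulRight X)) 1 = 0 := fun A X h => by simp [h]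
        exact key _ _ h2
      exact hB1 ▸ hB.hasDerivAt
    have := IsOpen.is_const_of_deriv_eq_zero Metric.isOpen_ball
      (convex_ball (0 : ℝ) ε).isPreconnected
      (fun s hs => (hderiv s hs).differentiableAt.differentiableWithinAt)
      (fun s hs => (hderiv s hs).deriv) ht (Metric.mem_ball_self hε)
    simpa [φ, hc0] using this
  have h1 : HasMFDerivAt 𝓘(ℝ, ℝ) IG c 0 0 :=
    (hasMFDerivAt_const (1 : G) (0 : ℝ)).congr_of_eventuallyEq
      (Filter.eventually_of_mem (Metric.ball_mem_nhds 0 hε) hconst)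
  have h2 := hasMFDerivAt_unique (hball 0 (Metric.mem_ball_self hε)) h1
  have h3 := congrArg (fun A : ℝ →L[ℝ] EG => A 1) h2
  have h4 : (1 : ℝ) • (mulInvariantVectorField v (c 0) : EG) = 0 := h3
  rw [one_smul, hc0] at h4
  have h5 : HasMFDerivAt IG IG (fun x : G => 1 * x) 1 (ContinuousLinearMap.id ℝ EG) :=
    (hasMFDerivAt_id (1 : G)).congr_of_eventuallyEq (Filter.Eventually.of_forall one_mul)
  have h6 : (mulInvariantVectorField v (1 : G) : EG) = v :=
    congrArg (fun A : EG →L[ℝ] EG => A v) h5.mfderiv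
  rw [h6] at h4
  exact h4

/-- Take `W` whose infinitesimal kernel has least dimension. Adding any `W'` cannot shrink it, so it
lies in the kernel of every `W'` and therefore vanishes. -/
theorem exists_isSmoothSubrep_infinitesimalKernel_eq_bot :
    ∃ W, IsSmoothSubrep IG μ W ∧ infinitesimalKernel IG μ W = ⊥ := by
  have : FiniteDimensional ℝ (GroupLieAlgebra IG G) := inferInstanceAs (FiniteDimensional ℝ EG)
  let d : {W // IsSmoothSubrep IG μ W} → ℕ := fun W =>
    Module.finrank ℝ (infinitesimalKernel IG μ W.1)
  have : Nonempty {W // IsSmoothSubrep IG μ W} := ⟨⟨⊥, IsSmoothSubrep.bot⟩⟩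
  obtain ⟨W, hW⟩ := (⟨_, fun W' => Function.argmin_le d W'⟩ : ∃ W, ∀ W', d W ≤ d W')
  refine ⟨W.1, W.2, (Submodule.eq_bot_iff _).2 fun v hv => ?_⟩
  refine eq_zero_of_forall_mem_infinitesimalKernel (μ := μ) fun W' hW' => ?_
  have hle : infinitesimalKernel IG μ (W.1 ⊔ W') ≤ infinitesimalKernel IG μ W.1 :=
    infinitesimalKernel_anti le_sup_left
  have heq := Submodule.eq_of_le_of_finrank_le hle (hW ⟨_, W.2.sup hW'⟩)
  exact infinitesimalKernel_anti le_sup_right (heq ▸ hv)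

end Infinitesimal

/-! ### Smooth and immersive operator-valued representations -/

section OperatorValued

variable {E HM M : Type*} [NormedAddCommGroup E] [NormedSpace ℝ E]
  [TopologicalSpace HM] {IM : ModelWithCorners ℝ E HM}
  [TopologicalSpace M] [ChartedSpace HM M]
  {V : Type*} [NormedAddCommGroup V] [InnerProductSpace ℂ V]

theorem contMDiff_of_coefficients [FiniteDimensional ℂ V] {ρ : M → V →L[ℂ] V}
    (h : ∀ v w : V, ContMDiff IM 𝓘(ℝ, ℂ) ∞ fun x => inner ℂ w (ρ x v)) :
    ContMDiff IM 𝓘(ℝ, V →L[ℂ] V) ∞ ρ := by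
  let b := stdOrthonormalBasis ℂ V
  have hsum : ∀ x, ρ x = ∑ i, ∑ j, ((inner ℂ (b i) (ρ x (b j)) : ℂ) •
      ((innerSL ℂ (b j)).smulRight (b i) : V →L[ℂ] V)) := by
    intro x
    refine ContinuousLinearMap.coe_injective (b.toBasis.ext fun j => ?_)
    rw [OrthonormalBasis.coe_toBasis]
    conv_lhs => rw [ContinuousLinearMap.coe_coe, ← b.sum_repr (ρ x (b j))]
    simp only [ContinuousLinearMap.coe_coe, sum_apply]
    refine Finset.sum_congr rfl fun i _ => ?_
    rw [Finset.sum_eq_single j]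
    · simp [b.repr_apply_apply]
    · intro k _ hk
      simp [b.inner_eq_ite, hk]
    · simp
  rw [show ρ = _ from funext hsum]
  refine contMDiff_finsetSum fun i _ => contMDiff_finsetSum fun j _ => ?_
  have hs : ContDiff ℝ ∞ fun z : ℂ => z • ((innerSL ℂ (b j)).smulRight (b i) : V →L[ℂ] V) :=
    ((ContinuousLinearMap.toSpanSingleton ℂ
      ((innerSL ℂ (b j)).smulRight (b i) : V →L[ℂ] V)).restrictScalars ℝ).contDiff
  exact hs.contMDiff.comp (h _ _)

theorem mfderiv_injective_of_coefficients {ρ : M → V →L[ℂ] V} {x : M}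
    (hρ : ContMDiff IM 𝓘(ℝ, V →L[ℂ] V) ∞ ρ)
    (h : ∀ t : TangentSpace IM x, (∀ (ℓ : V →L[ℂ] ℂ) (v : V),
      mfderiv IM 𝓘(ℝ, ℂ) (fun x => ℓ (ρ x v)) x t = 0) → t = 0) :
    Function.Injective (mfderiv IM 𝓘(ℝ, V →L[ℂ] V) ρ x) := by
  refine (injective_iff_map_eq_zero _).2 fun t ht => h t fun ℓ v => ?_
  let L : (V →L[ℂ] V) →L[ℝ] ℂ :=
    (ℓ.comp (ContinuousLinearMap.apply ℂ V v)).restrictScalars ℝ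
  have h1 : HasMFDerivAt IM 𝓘(ℝ, ℂ) (fun x => ℓ (ρ x v)) x
      (L.comp (mfderiv IM 𝓘(ℝ, V →L[ℂ] V) ρ x : E →L[ℝ] (V →L[ℂ] V))) :=
    L.hasMFDerivAt.comp x (hρ.mdifferentiableAt (by simp)).hasMFDerivAt
  rw [h1.mfderiv]
  change L (mfderiv IM 𝓘(ℝ, V →L[ℂ] V) ρ x t : V →L[ℂ] V) = 0
  rw [ht]
  exact map_zero L

variable {EG HG G : Type*} [NormedAddCommGroup EG] [NormedSpace ℝ EG] [TopologicalSpace HG]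
  {IG : ModelWithCorners ℝ EG HG} [TopologicalSpace G] [ChartedSpace HG G] [Group G]

variable (IG) in
/-- A smooth representation that has a smooth left inverse near the identity. -/
structure IsImmersiveRep (ρ : G →* (V →L[ℂ] V)) : Prop where
  smooth : ContMDiff IG 𝓘(ℝ, V →L[ℂ] V) ∞ ρ
  exists_leftInverse : ∃ r : (V →L[ℂ] V) → G,
    ContMDiffAt 𝓘(ℝ, V →L[ℂ] V) IG ∞ r 1 ∧ ∀ᶠ g in 𝓝 1, r (ρ g) = g

theorem isImmersiveRep_of_coefficients [FiniteDimensional ℂ V] [FiniteDimensional ℝ EG]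
    [IG.Boundaryless] [IsManifold IG ∞ G] {ρ : G →* (V →L[ℂ] V)}
    (h : ∀ v w : V, ContMDiff IG 𝓘(ℝ, ℂ) ∞ fun x => inner ℂ w (ρ x v))
    (h' : ∀ t : TangentSpace IG (1 : G), (∀ (ℓ : V →L[ℂ] ℂ) (v : V),
      mfderiv IG 𝓘(ℝ, ℂ) (fun x => ℓ (ρ x v)) 1 t = 0) → t = 0) :
    IsImmersiveRep IG ρ := by
  have hρ := contMDiff_of_coefficients h
  have : FiniteDimensional ℝ (V →L[ℂ] V) := Module.Finite.trans ℂ _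
  refine ⟨hρ, ?_⟩
  have := exists_contMDiffAt_leftInverse hρ (mfderiv_injective_of_coefficients hρ h')
  rwa [map_one] at this

end OperatorValued

/-! ### A faithful immersive unitary representation -/

section SubrepHom

variable {EG HG : Type*} [NormedAddCommGroup EG] [NormedSpace ℝ EG] [TopologicalSpace HG]
  {IG : ModelWithCorners ℝ EG HG}
  {G : Type*} [TopologicalSpace G] [ChartedSpace HG G] [Group G] [IsTopologicalGroup G]
  [MeasurableSpace G] [BorelSpace G] {μ : Measure G} [μ.IsMulLeftInvariant]

/-- The representation of `G` on a subrepresentation of `L²(G)`. -/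
noncomputable def IsSmoothSubrep.hom {W : Submodule ℂ (Lp ℂ 2 μ)} (hW : IsSmoothSubrep IG μ W) :
    G →* (W →L[ℂ] W) where
  toFun g := (leftTranslate μ g).toContinuousLinearMap.restrict (hW.invariant g)
  map_one' := ContinuousLinearMap.ext fun _ => Subtype.ext (leftTranslate_one μ _)
  map_mul' g h := ContinuousLinearMap.ext fun _ => Subtype.ext (leftTranslate_mul μ g h _)

@[simp]
theorem IsSmoothSubrep.coe_hom_apply {W : Submodule ℂ (Lp ℂ 2 μ)} (hW : IsSmoothSubrep IG μ W)
    (g : G) (f : W) : (hW.hom g f : Lp ℂ 2 μ) = leftTranslate μ g f := rfl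

variable [FiniteDimensional ℝ EG] [IG.Boundaryless] [LieGroup IG ∞ G]

theorem IsSmoothSubrep.isImmersiveRep_hom {W : Submodule ℂ (Lp ℂ 2 μ)}
    (hW : IsSmoothSubrep IG μ W) (h0 : infinitesimalKernel IG μ W = ⊥) :
    IsImmersiveRep IG hW.hom := by
  have := hW.finiteDimensional
  refine isImmersiveRep_of_coefficients (fun v w => hW.smooth w v v.2) fun t ht => ?_
  have htW : t ∈ infinitesimalKernel IG μ W := fun w f hf =>
    ht ((innerSL ℂ w).comp W.subtypeL) ⟨f, hf⟩
  rwa [h0, Submodule.mem_bot] at htW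

variable [CompactSpace G] [T2Space G] [IsFiniteMeasure μ] [μ.IsOpenPosMeasure]

/-- A subrepresentation with trivial infinitesimal kernel is already faithful on a neighbourhood `U`
of `1`. Each point of the compact complement is moved by some subrepresentation, which then also
moves all nearby points, so a finite sum takes care of the complement. -/
theorem exists_isSmoothSubrep_faithful :
    ∃ W, IsSmoothSubrep IG μ W ∧ infinitesimalKernel IG μ W = ⊥ ∧
      ∀ g : G, (∀ f ∈ W, leftTranslate μ g f = f) → g = 1 := by
  obtain ⟨W, hW, hW0⟩ := exists_isSmoothSubrep_infinitesimalKernel_eq_bot (IG := IG) (μ := μ)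
  obtain ⟨r, -, hr⟩ := (hW.isImmersiveRep_hom hW0).exists_leftInverse
  obtain ⟨U, hU, hUo, h1U⟩ := eventually_nhds_iff.1 hr
  have key : ∃ W', IsSmoothSubrep IG μ W' ∧
      ∀ g ∈ Uᶜ, ¬ ∀ f ∈ W', leftTranslate μ g f = f := by
    refine hUo.isClosed_compl.isCompact.induction_on
      (p := fun s => ∃ W', IsSmoothSubrep IG μ W' ∧ ∀ g ∈ s, ¬ ∀ f ∈ W', leftTranslate μ g f = f)
      ⟨⊥, IsSmoothSubrep.bot, by simp⟩ ?_ ?_ ?_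
    · rintro s t hst ⟨W', hW', h⟩
      exact ⟨W', hW', fun g hg => h g (hst hg)⟩
    · rintro s t ⟨W₁, hW₁, h₁⟩ ⟨W₂, hW₂, h₂⟩
      refine ⟨W₁ ⊔ W₂, hW₁.sup hW₂, ?_⟩
      rintro g (hg | hg) hfix
      · exact h₁ g hg fun f hf => hfix f (Submodule.mem_sup_left hf)
      · exact h₂ g hg fun f hf => hfix f (Submodule.mem_sup_right hf)
    · intro g hg
      have hg1 : g ≠ 1 := by
        rintro rfl
        exact hg h1U
      obtain ⟨W', hW', f, hf, hne⟩ := exists_isSmoothSubrep_ne (IG := IG) (μ := μ) hg1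
      obtain ⟨w, hw⟩ : ∃ w, inner ℂ w (leftTranslate μ g f) ≠ inner ℂ w f := by
        by_contra! hcon
        exact hne (ext_inner_left ℂ hcon)
      have hopen : IsOpen {h : G | inner ℂ w (leftTranslate μ h f) ≠ inner ℂ w f} :=
        isOpen_ne_fun (hW'.smooth w f hf).continuous continuous_const
      refine ⟨_, mem_nhdsWithin_of_mem_nhds (hopen.mem_nhds hw), W', hW', fun h hh hfix => ?_⟩
      exact hh (by rw [hfix f hf])
  obtain ⟨W', hW', hne⟩ := key
  refine ⟨W ⊔ W', hW.sup hW', ?_, fun g hg => ?_⟩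
  · exact le_bot_iff.1 ((infinitesimalKernel_anti le_sup_left).trans hW0.le)
  · by_cases hgU : g ∈ U
    · have hρ : hW.hom g = hW.hom 1 := by
        rw [map_one]
        exact ContinuousLinearMap.ext fun f =>
          Subtype.ext (hg f (Submodule.mem_sup_left f.2))
      rw [← hU g hgU, hρ, hU 1 h1U]
    · exact absurd (fun f hf => hg f (Submodule.mem_sup_right hf)) (hne g hgU)

end SubrepHom

universe u

/-- Every compact Lie group has a faithful finite-dimensional unitary representation that is a
smooth immersion. -/
theorem exists_faithful_unitary_rep {EG HG : Type*} {G : Type u}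
    [NormedAddCommGroup EG] [NormedSpace ℝ EG] [FiniteDimensional ℝ EG] [TopologicalSpace HG]
    (IG : ModelWithCorners ℝ EG HG)
    [IG.Boundaryless] [TopologicalSpace G] [ChartedSpace HG G] [Group G] [LieGroup IG ∞ G]
    [CompactSpace G] [T2Space G] :
    ∃ (V : Type u) (_ : NormedAddCommGroup V) (_ : InnerProductSpace ℂ V)
      (_ : FiniteDimensional ℂ V) (ρ : G →* (V →L[ℂ] V)),
      (∀ g v, ‖ρ g v‖ = ‖v‖) ∧ Function.Injective ρ ∧ IsImmersiveRep IG ρ := by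
  have : IsTopologicalGroup G := topologicalGroup_of_lieGroup IG ∞
  let _ : MeasurableSpace G := borel G
  have : BorelSpace G := ⟨rfl⟩
  let μ : Measure G := Measure.haarMeasure ⊤
  obtain ⟨W, hW, hW0, hfaith⟩ := exists_isSmoothSubrep_faithful (IG := IG) (μ := μ)
  refine ⟨W, inferInstance, inferInstance, hW.finiteDimensional, hW.hom,
    fun g v => (leftTranslate μ g).norm_map v, ?_, hW.isImmersiveRep_hom hW0⟩
  refine (injective_iff_map_eq_one _).2 fun g hg => hfaith g fun f hf => ?_
  have := congrArg (fun A : W →L[ℂ] W => (A ⟨f, hf⟩ : Lp ℂ 2 μ)) hg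
  simpa using this

/-! ### Unitary representations of abelian groups and characters -/

section Characters

variable {A V : Type*} [CommGroup A] [TopologicalSpace A]
  [NormedAddCommGroup V] [InnerProductSpace ℂ V]

/-- A group acting by scalars on a nonzero invariant subspace acts through a character. -/
theorem exists_character_of_forall_smul {ρ : A →* (V →L[ℂ] V)} (hρ : ∀ a v, ‖ρ a v‖ = ‖v‖)
    (hcont : ∀ v, Continuous fun a => ρ a v) {E : Submodule ℂ V} (hE : E ≠ ⊥)
    (hscalar : ∀ a, ∃ c : ℂ, ∀ v ∈ E, ρ a v = c • v) :
    ∃ χ : A →ₜ* Circle, ∀ a, ∀ v ∈ E, ρ a v = (χ a : ℂ) • v := by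
  choose c hc using hscalar
  obtain ⟨v, hv, hv0⟩ := E.ne_bot_iff.1 hE
  have hcan : ∀ {x y : ℂ}, x • v = y • v → x = y := fun h => smul_left_injective ℂ hv0 h
  have hmem : ∀ a, c a ∈ Submonoid.unitSphere ℂ := fun a => by
    have h := hρ a v
    rw [hc a v hv, norm_smul] at h
    exact mem_sphere_zero_iff_norm.2 ((mul_eq_right₀ (norm_ne_zero_iff.2 hv0)).1 h)
  have hcc : Continuous c := by
    have h : c = fun a => inner ℂ v (ρ a v) / inner ℂ v v := by
      ext a
      rw [hc a v hv, inner_smul_right, mul_div_cancel_right₀ _ (inner_self_ne_zero.2 hv0)]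
    rw [h]
    exact (continuous_const.inner (hcont v)).div_const _
  refine ⟨⟨⟨⟨fun a => ⟨c a, hmem a⟩, ?_⟩, ?_⟩, ?_⟩, fun a w hw => hc a w hw⟩
  · refine Subtype.ext (hcan ?_)
    rw [← hc 1 v hv, map_one]
    simp
  · intro a b
    refine Subtype.ext (hcan ?_)
    change c (a * b) • v = (c a * c b) • v
    rw [← hc _ v hv, map_mul, mul_apply_eq_comp, hc b v hv, map_smul, hc a v hv,
      smul_smul, mul_comm]
  · exact hcc.subtype_mk _

/-- Simultaneous diagonalization by induction on dimension. If some `ρ a` is not scalar on `E`, one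
of its eigenspaces is invariant by commutativity and the orthogonal complement is invariant by
unitarity; both are proper in `E`. -/
theorem exists_finite_characters_of_submodule [FiniteDimensional ℂ V] {ρ : A →* (V →L[ℂ] V)}
    (hρ : ∀ a v, ‖ρ a v‖ = ‖v‖) (hcont : ∀ v, Continuous fun a => ρ a v) (n : ℕ)
    (E : Submodule ℂ V) (hn : Module.finrank ℂ E = n) (hE : ∀ a, ∀ v ∈ E, ρ a v ∈ E) :
    ∃ s : Set (A →ₜ* Circle), s.Finite ∧ ∀ a, (∀ χ ∈ s, χ a = 1) → ∀ v ∈ E, ρ a v = v := by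
  induction n using Nat.strong_induction_on generalizing E with
  | _ n ih =>
  by_cases hbot : E = ⊥
  · exact ⟨∅, Set.finite_empty, fun a _ v hv => by simp [(Submodule.mem_bot ℂ).1 (hbot ▸ hv)]⟩
  by_cases hscalar : ∀ a, ∃ c : ℂ, ∀ v ∈ E, ρ a v = c • v
  · obtain ⟨χ, hχ⟩ := exists_character_of_forall_smul hρ hcont hbot hscalar
    exact ⟨{χ}, Set.finite_singleton χ, fun a ha v hv => by simp [hχ a v hv, ha χ rfl]⟩
  push Not at hscalar
  obtain ⟨a, ha⟩ := hscalar
  have : Nontrivial E := E.nontrivial_iff_ne_bot.2 hbot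
  obtain ⟨c, hc⟩ := Module.End.exists_eigenvalue ((ρ a).toLinearMap.restrict (hE a))
  obtain ⟨w, hw, hw0⟩ := hc.exists_hasEigenvector
  let E₁ : Submodule ℂ V := E ⊓ Module.End.eigenspace (ρ a).toLinearMap c
  have hmem₁ : ∀ {v}, v ∈ E₁ ↔ v ∈ E ∧ ρ a v = c • v := fun {v} => by
    simp [E₁]
  have hE₁ : ∀ b, ∀ v ∈ E₁, ρ b v ∈ E₁ := fun b v hv => by
    rw [hmem₁] at hv ⊢
    refine ⟨hE b v hv.1, ?_⟩
    rw [← mul_apply_eq_comp, ← map_mul, mul_comm, map_mul,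
      mul_apply_eq_comp, hv.2, map_smul]
  let E₂ : Submodule ℂ V := E ⊓ E₁ᗮ
  have hinner : ∀ b u v, inner ℂ u (ρ b v) = inner ℂ (ρ b⁻¹ u) v := fun b u v => by
    let L : V →ₗᵢ[ℂ] V := ⟨(ρ b).toLinearMap, hρ b⟩
    have h := L.inner_map_map (ρ b⁻¹ u) v
    have h2 : L (ρ b⁻¹ u) = u := by
      change (ρ b * ρ b⁻¹) u = u
      rw [← map_mul, mul_inv_cancel, map_one]
      rfl
    rw [h2] at h
    exact h
  have hE₂ : ∀ b, ∀ v ∈ E₂, ρ b v ∈ E₂ := fun b v hv => by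
    refine ⟨hE b v hv.1, (Submodule.mem_orthogonal _ _).2 fun u hu => ?_⟩
    rw [hinner]
    exact (Submodule.mem_orthogonal _ _).1 hv.2 _ (hE₁ _ u hu)
  have hwE : (w : V) ∈ E₁ := hmem₁.2 ⟨w.2, by
    have := Module.End.mem_eigenspace_iff.1 hw
    exact congrArg Subtype.val this⟩
  have hlt₁ : E₁ < E := by
    refine lt_of_le_of_ne inf_le_left fun h => ?_
    obtain ⟨v, hv, hne⟩ := ha c
    exact hne (hmem₁.1 (h.ge hv)).2
  have hlt₂ : E₂ < E := by
    refine lt_of_le_of_ne inf_le_left fun h => hw0 (Subtype.ext ?_)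
    have h2 : (w : V) ∈ E₂ := h.ge w.2
    exact inner_self_eq_zero.1 ((Submodule.mem_orthogonal _ _).1 h2.2 _ hwE)
  obtain ⟨s₁, hs₁, h₁⟩ := ih _ ((Submodule.finrank_lt_finrank_of_lt hlt₁).trans_eq hn) E₁ rfl hE₁
  obtain ⟨s₂, hs₂, h₂⟩ := ih _ ((Submodule.finrank_lt_finrank_of_lt hlt₂).trans_eq hn) E₂ rfl hE₂
  refine ⟨s₁ ∪ s₂, hs₁.union hs₂, fun b hb v hv => ?_⟩
  have hP : E₁.starProjection v ∈ E₁ := Submodule.starProjection_apply_mem _ _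
  have hQ : v - E₁.starProjection v ∈ E₂ :=
    ⟨E.sub_mem hv hP.1, Submodule.sub_starProjection_mem_orthogonal _⟩
  have e₁ := h₁ b (fun χ hχ => hb χ (Or.inl hχ)) _ hP
  have e₂ := h₂ b (fun χ hχ => hb χ (Or.inr hχ)) _ hQ
  calc ρ b v = ρ b (E₁.starProjection v) + ρ b (v - E₁.starProjection v) := by
        rw [← map_add, add_sub_cancel]
    _ = v := by rw [e₁, e₂, add_sub_cancel]

/-- The kernel of a finite-dimensional unitary representation of a commutative group is the
common kernel of finitely many characters. -/
theorem exists_finite_characters [FiniteDimensional ℂ V] {ρ : A →* (V →L[ℂ] V)}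
    (hρ : ∀ a v, ‖ρ a v‖ = ‖v‖) (hcont : ∀ v, Continuous fun a => ρ a v) :
    ∃ s : Set (A →ₜ* Circle), s.Finite ∧ ∀ a, (∀ χ ∈ s, χ a = 1) → ρ a = 1 := by
  obtain ⟨s, hs, h⟩ := exists_finite_characters_of_submodule hρ hcont _ ⊤ rfl (by simp)
  exact ⟨s, hs, fun a ha => ContinuousLinearMap.ext fun v => h a ha v trivial⟩

end Characters

/-! ### Compact groups mapping onto a torus -/

section FullTorus

/-- The integral of a nontrivial character over a compact group vanishes. -/
theorem integral_character_eq_zero {K : Type*} [Group K] [TopologicalSpace K]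
    [IsTopologicalGroup K] [MeasurableSpace K] [BorelSpace K] (μ : Measure K)
    [μ.IsMulLeftInvariant] {χ : K →* Circle} {a : K} (ha : χ a ≠ 1) :
    ∫ x, (χ x : ℂ) ∂μ = 0 := by
  have h := integral_mul_left_eq_self (μ := μ) (fun x => (χ x : ℂ)) a
  simp only [map_mul, Circle.coe_mul] at h
  rw [integral_const_mul] at h
  have ha' : (χ a : ℂ) - 1 ≠ 0 := fun h0 => ha (Circle.ext (sub_eq_zero.1 h0))
  refine (mul_eq_zero.1 (?_ : ((χ a : ℂ) - 1) * _ = 0)).resolve_left ha'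
  rw [sub_mul, h, one_mul, sub_self]

variable {n : ℕ}

/-- The identification of the two models of the `n`-torus. -/
noncomputable def torusHomeomorph (n : ℕ) : UnitAddTorus (Fin n) ≃ₜ (Fin n → Circle) :=
  Homeomorph.piCongrRight fun _ => AddCircle.homeomorphCircle one_ne_zero

theorem mFourier_torusHomeomorph_symm (m : Fin n → ℤ) (y : Fin n → Circle) :
    UnitAddTorus.mFourier m ((torusHomeomorph n).symm y) = ((∏ i, y i ^ m i : Circle) : ℂ) := by
  obtain ⟨x, rfl⟩ := (torusHomeomorph n).surjective y
  rw [Homeomorph.symm_apply_apply]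
  change ∏ i, fourier (m i) (x i) = Circle.coeHom (∏ i, (torusHomeomorph n x) i ^ m i)
  rw [map_prod]
  refine Finset.prod_congr rfl fun i _ => ?_
  rw [fourier_apply, AddCircle.toCircle_zsmul]
  change _ = (((torusHomeomorph n x) i ^ m i : Circle) : ℂ)
  simp [torusHomeomorph, AddCircle.homeomorphCircle_apply]

/-- Integration of functions on the torus along a map from a compact space. -/
noncomputable def integralAlong {K : Type*} [TopologicalSpace K] [CompactSpace K]
    [MeasurableSpace K] [BorelSpace K] (μ : Measure K) [IsFiniteMeasure μ]
    (j : C(K, Fin n → Circle)) : C(UnitAddTorus (Fin n), ℂ) →L[ℂ] ℂ :=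
  have hint : ∀ F : C(UnitAddTorus (Fin n), ℂ),
      Integrable (fun k => F ((torusHomeomorph n).symm (j k))) μ := fun F =>
    Continuous.integrable_of_hasCompactSupport (by fun_prop) (HasCompactSupport.of_compactSpace _)
  LinearMap.mkContinuous
    { toFun := fun F => ∫ k, F ((torusHomeomorph n).symm (j k)) ∂μ
      map_add' := fun F F' => integral_add (hint F) (hint F')
      map_smul' := fun c F => integral_smul c _ }
    (μ.real Set.univ) fun F => by
      rw [mul_comm]
      exact norm_integral_le_of_norm_le_const (Filter.Eventually.of_forall fun k =>
        F.norm_coe_le_norm _)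

theorem integralAlong_apply {K : Type*} [TopologicalSpace K] [CompactSpace K]
    [MeasurableSpace K] [BorelSpace K] (μ : Measure K) [IsFiniteMeasure μ]
    (j : C(K, Fin n → Circle)) (F : C(UnitAddTorus (Fin n), ℂ)) :
    integralAlong μ j F = ∫ k, F ((torusHomeomorph n).symm (j k)) ∂μ := rfl

/-- A monomial composed with `j` is a character of `K`, nontrivial for `m ≠ 0`, so its integral
vanishes. The value does not depend on `K` or `j`, which allows two such integrals to be compared.
-/
theorem integralAlong_mFourier {K : Type*} [Group K] [TopologicalSpace K]
    [IsTopologicalGroup K] [CompactSpace K] [MeasurableSpace K] [BorelSpace K] (μ : Measure K)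
    [μ.IsMulLeftInvariant] [IsProbabilityMeasure μ] (j : K →ₜ* (Fin n → Circle))
    (hj : ∀ m : Fin n → ℤ, m ≠ 0 → ∃ k, ∏ i, j k i ^ m i ≠ 1) (m : Fin n → ℤ) :
    integralAlong μ (j : C(K, Fin n → Circle)) (UnitAddTorus.mFourier m) =
      if m = 0 then 1 else 0 := by
  rw [integralAlong_apply]
  simp only [mFourier_torusHomeomorph_symm]
  split_ifs with hm
  · simp [hm]
  · obtain ⟨k, hk⟩ := hj m hm
    let χ : K →* Circle :=
      { toFun := fun k => ∏ i, j k i ^ m i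
        map_one' := by simp
        map_mul' := fun a b => by simp [mul_zpow, Finset.prod_mul_distrib] }
    exact integral_character_eq_zero μ (χ := χ) hk

/-- A homomorphism from a compact group to the torus is surjective if no nontrivial monomial
is trivial on its image. -/
theorem surjective_of_monomials {K : Type*} [Group K] [TopologicalSpace K]
    [IsTopologicalGroup K] [CompactSpace K] (j : K →ₜ* (Fin n → Circle))
    (hj : ∀ m : Fin n → ℤ, m ≠ 0 → ∃ k, ∏ i, j k i ^ m i ≠ 1) : Function.Surjective j := by
  by_contra hsurj
  obtain ⟨y, hy⟩ := not_forall.1 hsurj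
  let _ : MeasurableSpace K := borel K
  have : BorelSpace K := ⟨rfl⟩
  let μ : Measure K := Measure.haarMeasure ⊤
  have : IsProbabilityMeasure μ := ⟨Measure.haarMeasure_self⟩
  let _ : MeasurableSpace (Fin n → Circle) := borel _
  have : BorelSpace (Fin n → Circle) := ⟨rfl⟩
  let ν : Measure (Fin n → Circle) := Measure.haarMeasure ⊤
  have : IsProbabilityMeasure ν := ⟨Measure.haarMeasure_self⟩
  -- The image of Haar measure on `K` and Haar measure on the torus have the same Fourier
  -- coefficients, and trigonometric polynomials are dense in the continuous functions.
  have heq : integralAlong μ (j : C(K, Fin n → Circle)) =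
      integralAlong ν (ContinuousMap.id (Fin n → Circle)) := by
    refine ContinuousLinearMap.ext_on (s := Set.range (UnitAddTorus.mFourier (d := Fin n)))
      ?_ ?_
    · exact Submodule.dense_iff_topologicalClosure_eq_top.2
        UnitAddTorus.span_mFourier_closure_eq_top
    · rintro _ ⟨m, rfl⟩
      rw [integralAlong_mFourier μ j hj]
      exact (integralAlong_mFourier ν (ContinuousMonoidHom.id (Fin n → Circle)) (fun m hm =>
        let ⟨k, hk⟩ := hj m hm
        ⟨j k, hk⟩) m).symm
  have hclosed : IsClosed (Set.range j) := (isCompact_range j.continuous_toFun).isClosed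
  -- An Urysohn function vanishing on the image but not at the missed point `y` has integral zero on
  -- one side and positive integral on the other.
  obtain ⟨f, hf0, hf1, hf01⟩ := exists_continuous_zero_one_of_isClosed hclosed
    (isClosed_singleton (x := y)) (Set.disjoint_singleton_right.2 hy)
  let F : C(UnitAddTorus (Fin n), ℂ) :=
    ⟨fun x => (f (torusHomeomorph n x) : ℂ), by fun_prop⟩
  have h1 : integralAlong μ (j : C(K, Fin n → Circle)) F = 0 := by
    rw [integralAlong_apply]
    refine integral_eq_zero_of_ae (Filter.Eventually.of_forall fun k => ?_)
    have : f (j k) = 0 := hf0 ⟨k, rfl⟩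
    simp [F, this]
  have h2 : integralAlong ν (ContinuousMap.id (Fin n → Circle)) F = ((∫ y, f y ∂ν : ℝ) : ℂ) := by
    rw [integralAlong_apply, ← integral_complex_ofReal]
    simp [F]
  have h3 : 0 < ∫ y, f y ∂ν :=
    f.continuous.integral_pos_of_hasCompactSupport_nonneg_nonzero
      (HasCompactSupport.of_compactSpace _) (fun x => (hf01 x).1)
      (x := y) (by rw [hf1 rfl]; simp)
  rw [heq, h2, Complex.ofReal_eq_zero] at h1
  exact h3.ne' h1

end FullTorus

/-! ### A criterion for an image to be a torus -/

section TorusRange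

variable {A B : Type*} [CommGroup A] [TopologicalSpace A] [Group B] [TopologicalSpace B]

/-- Evaluation of characters at a point. -/
noncomputable def evalCharacter (a : A) : (A →ₜ* Circle) →* Circle where
  toFun χ := χ a
  map_one' := rfl
  map_mul' _ _ := rfl

@[simp]
theorem evalCharacter_apply (a : A) (χ : A →ₜ* Circle) : evalCharacter a χ = χ a := rfl

/-- A finitely generated torsion-free group of characters has a multiplicative basis. -/
theorem exists_character_basis {s : Set (A →ₜ* Circle)} (hs : s.Finite)
    (htf : ∀ χ ∈ Subgroup.closure s, ∀ k : ℤ, k ≠ 0 → χ ^ k = 1 → χ = 1) :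
    ∃ (n : ℕ) (Y : A →ₜ* (Fin n → Circle)),
      (∀ a, Y a = 1 ↔ ∀ χ ∈ s, χ a = 1) ∧
      ∀ m : Fin n → ℤ, m ≠ 0 → ∃ a, ∏ i, Y a i ^ m i ≠ 1 := by
  let M := Subgroup.closure s
  have hfg : Module.Finite ℤ (Additive M) := by
    have : Group.FG M := (Group.fg_iff_subgroup_fg M).2 ⟨hs.toFinset, by simp [M]⟩
    exact Module.Finite.iff_addGroup_fg.2 inferInstance
  have htors : Module.IsTorsionFree ℤ (Additive M) := by
    refine Module.isTorsionFree_iff_smul_eq_zero.2 fun k x h => ?_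
    by_contra! hcon
    refine hcon.2 (htf _ x.toMul.2 k hcon.1 (congrArg Subtype.val h) |> fun h' => ?_)
    exact Subtype.ext h'
  -- A ℤ-basis of the generated group supplies the coordinates of `Y`: generation gives the same
  -- common kernel, independence excludes trivial monomials.
  obtain ⟨n, b⟩ := Module.basisOfFiniteTypeTorsionFree' (R := ℤ) (M := Additive M)
  let y : Fin n → (A →ₜ* Circle) := fun i => ((b i).toMul : M)
  have hcomb : ∀ m : Fin n → ℤ, (((∑ i, m i • b i).toMul : M) : A →ₜ* Circle) =
      ∏ i, y i ^ m i := by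
    intro m
    rw [toMul_sum]
    simp [y]
  let Y : A →ₜ* (Fin n → Circle) :=
    ⟨MonoidHom.pi fun i => (y i).toMonoidHom,
      continuous_pi fun i => (y i).continuous_toFun⟩
  have hY : ∀ a i, Y a i = y i a := fun a i => rfl
  have hprod : ∀ a (m : Fin n → ℤ), (∏ i, y i ^ m i) a = ∏ i, Y a i ^ m i := fun a m => by
    rw [← evalCharacter_apply a, map_prod]
    exact Finset.prod_congr rfl fun i _ => map_zpow (evalCharacter a) (y i) (m i)
  refine ⟨n, Y, fun a => ⟨fun ha χ hχ => ?_, fun ha => funext fun i => ?_⟩, fun m hm => ?_⟩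
  · have hχM : χ ∈ M := Subgroup.subset_closure hχ
    have h1 := hcomb fun i => b.repr (Additive.ofMul ⟨χ, hχM⟩) i
    rw [b.sum_repr] at h1
    change χ = _ at h1
    rw [h1, hprod, ha]
    simp
  · have hle : M ≤ (evalCharacter a).ker := (Subgroup.closure_le _).2 ha
    exact hle ((b i).toMul : M).2
  · by_contra! hcon
    refine hm ?_
    have h1 : ∑ i, m i • b i = 0 := by
      have : ((∑ i, m i • b i).toMul : M) = 1 := Subtype.ext <| by
        rw [hcomb]
        ext a : 1
        rw [hprod, hcon a]
        rfl
      exact this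
    exact funext fun i => Fintype.linearIndependent_iff.1 b.linearIndependent m h1 i

variable [T2Space B]

/-- Suppose that the kernel of `τ` is the common kernel of finitely many characters, that `τ`
has the same image as on a compact set, and that the characters killing its kernel form a
torsion-free group. Then the image of `τ` is a torus. -/
theorem isTorusGroup_range (τ : A →ₜ* B) {s : Set (A →ₜ* Circle)} (hs : s.Finite)
    (hker : ∀ a, τ a = 1 ↔ ∀ χ ∈ s, χ a = 1)
    (htf : ∀ χ : A →ₜ* Circle, (∀ a, τ a = 1 → χ a = 1) → ∀ k : ℤ, k ≠ 0 → χ ^ k = 1 → χ = 1)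
    {C : Set A} (hC : IsCompact C) (hτC : ∀ a, ∃ c ∈ C, τ c = τ a) :
    IsTorusGroup τ.toMonoidHom.range := by
  obtain ⟨n, Y, hY, hmon⟩ := exists_character_basis hs fun χ hχ => htf χ fun a ha =>
    (Subgroup.closure_le (evalCharacter a).ker).2 ((hker a).1 ha) hχ
  have hYτ : ∀ a a', Y a = Y a' ↔ τ a = τ a' := fun a a' => by
    rw [← div_eq_one, ← map_div, hY, ← hker, div_eq_mul_inv, map_mul, map_inv, mul_inv_eq_one]
  have hrange : Y '' C = Set.range Y := by
    refine subset_antisymm (Set.image_subset_range _ _) ?_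
    rintro _ ⟨a, rfl⟩
    obtain ⟨c, hc, hca⟩ := hτC a
    exact ⟨c, hc, (hYτ _ _).2 hca⟩
  have hsurj : Function.Surjective Y := by
    have : CompactSpace Y.toMonoidHom.range :=
      isCompact_iff_compactSpace.1 (by
        change IsCompact (Set.range Y)
        exact hrange ▸ hC.image Y.continuous_toFun)
    have := surjective_of_monomials (K := Y.toMonoidHom.range)
      ⟨Y.toMonoidHom.range.subtype, continuous_subtype_val⟩ fun m hm => by
        obtain ⟨a, ha⟩ := hmon m hm
        exact ⟨⟨Y a, a, rfl⟩, ha⟩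
    intro y
    obtain ⟨⟨_, a, rfl⟩, rfl⟩ := this y
    exact ⟨a, rfl⟩
  -- Any set-theoretic section will do: `Y` and `τ` have the same fibres, so `τ ∘ σ` is independent
  -- of the choice and multiplicative.
  choose σ hσ using hsurj
  let f₀ : (Fin n → Circle) →* τ.toMonoidHom.range :=
    { toFun := fun y => ⟨τ (σ y), σ y, rfl⟩
      map_one' := Subtype.ext (((hYτ _ 1).1 (by rw [hσ, map_one])).trans (map_one τ))
      map_mul' := fun y y' => Subtype.ext
        (((hYτ _ (σ y * σ y')).1 (by rw [map_mul, hσ, hσ, hσ])).trans (map_mul τ _ _)) }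
  let f : (Fin n → Circle) ≃* τ.toMonoidHom.range := MulEquiv.ofBijective f₀
    ⟨fun y y' h => by
      rw [← hσ y, ← hσ y']
      exact (hYτ _ _).2 (congrArg Subtype.val h),
     fun ⟨b, a, ha⟩ => ⟨Y a, Subtype.ext (((hYτ _ _).1 (hσ (Y a))).trans ha)⟩⟩
  have hfY : ∀ a, (f (Y a) : B) = τ a := fun a => (hYτ _ _).1 (hσ (Y a))
  have : CompactSpace C := isCompact_iff_compactSpace.1 hC
  have hYC : Continuous fun c : C => Y c := Y.continuous_toFun.comp continuous_subtype_val
  -- Continuity is tested on `C`, which maps onto the torus by a closed map; there the isomorphism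
  -- becomes `τ`.
  have hquot : Topology.IsQuotientMap fun c : C => Y c := by
    refine hYC.isClosedMap.isQuotientMap hYC fun y => ?_
    obtain ⟨c, hc, hcy⟩ : y ∈ Y '' C := by
      rw [hrange]
      exact ⟨σ y, hσ y⟩
    exact ⟨⟨c, hc⟩, hcy⟩
  have hf : Continuous f := by
    refine hquot.continuous_iff.2 (continuous_induced_rng.2 ?_)
    have : (Subtype.val ∘ (f ∘ fun c : C => Y c)) = fun c : C => τ c := funext fun c => hfY c
    rw [this]
    exact τ.continuous_toFun.comp continuous_subtype_val
  let e := Continuous.homeoOfEquivCompactToT2 (f := f.toEquiv) hf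
  exact ⟨n, ⟨ContinuousMulEquiv.symm ⟨f, hf, e.symm.continuous⟩⟩⟩

end TorusRange

/-! ### The torus does not embed in a circle -/

section NotCircle

/-- One-dimensional Borsuk–Ulam: the difference of the values at antipodal points changes sign over
half a turn. -/
theorem not_injective_circle_real {f : Circle → ℝ} (hf : Continuous f) :
    ¬ Function.Injective f := by
  intro hinj
  let g : ℝ → ℝ := fun t => f (Circle.exp t) - f (Circle.exp (t + Real.pi))
  have hg : Continuous g := by fun_prop
  have h0 : g Real.pi = - g 0 := by
    simp only [g, zero_add, Circle.exp_zero, neg_sub]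
    rw [← two_mul, Circle.exp_two_pi]
  obtain ⟨t, ht⟩ : ∃ t, g t = 0 := by
    have := mem_range_of_exists_le_of_exists_ge hg (c := 0)
    rcases le_total (g 0) 0 with h | h
    · exact this ⟨0, h⟩ ⟨Real.pi, by linarith⟩
    · exact this ⟨Real.pi, by linarith⟩ ⟨0, h⟩
  have h1 := hinj (sub_eq_zero.1 ht)
  rw [Circle.exp_add, left_eq_mul] at h1
  have h2 := congrArg (fun z : Circle => (z : ℂ)) h1
  simp [Circle.coe_exp] at h2
  norm_num [Complex.ext_iff] at h2

/-- If `j` is injective, at most one of the disjoint circles over `1` and `-1` meets the fibre over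
`0`. The other is mapped into a circle minus a point, that is, into an interval. -/
theorem not_injective_torus_addCircle {p : ℝ} [hp : Fact (0 < p)]
    {j : Circle × Circle → AddCircle p} (hj : Continuous j) : ¬ Function.Injective j := by
  intro hinj
  obtain ⟨y, hy⟩ : ∃ y, ∀ x, j (x, y) ≠ ((0 : ℝ) : AddCircle p) := by
    by_contra! hcon
    obtain ⟨x, hx⟩ := hcon 1
    obtain ⟨x', hx'⟩ := hcon (Circle.exp Real.pi)
    have h1 := congrArg Prod.snd (hinj (hx.trans hx'.symm))
    have h2 := congrArg (fun z : Circle => (z : ℂ)) h1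
    simp [Circle.coe_exp] at h2
    norm_num [Complex.ext_iff] at h2
  refine not_injective_circle_real (f := fun x => (AddCircle.equivIco p 0 (j (x, y)) : ℝ)) ?_ ?_
  · refine continuous_iff_continuousAt.2 fun x => ?_
    have h1 : ContinuousAt (AddCircle.equivIco p 0) (j (x, y)) :=
      AddCircle.continuousAt_equivIco p 0 (hy x)
    have h2 : ContinuousAt (fun x => j (x, y)) x := by fun_prop
    exact continuousAt_subtype_val.comp (h1.comp (f := fun x => j (x, y)) h2)
  · intro x x' h
    have := hinj ((AddCircle.equivIco p 0).injective (Subtype.ext h))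
    exact congrArg Prod.fst this

end NotCircle

/-! ### The period group is a lattice -/

section Lattice

/-- A closed subgroup of the plane that accumulates at zero contains a line. -/
theorem exists_line_of_accumulating {Λ : AddSubgroup ℂ} (hcl : IsClosed (Λ : Set ℂ))
    (hacc : ∀ ε > 0, ∃ x ∈ Λ, x ≠ 0 ∧ ‖x‖ < ε) : ∃ v : ℂ, v ≠ 0 ∧ ∀ t : ℝ, t • v ∈ Λ := by
  choose x hx hx0 hxε using fun n : ℕ => hacc (1 / (n + 1 : ℝ)) (by positivity)
  have hu : ∀ n, (‖x n‖⁻¹ • x n) ∈ Metric.sphere (0 : ℂ) 1 := fun n => by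
    simp [inv_mul_cancel₀ (norm_ne_zero_iff.2 (hx0 n))]
  obtain ⟨v, hv, φ, hφ, hlim⟩ := (isCompact_sphere (0 : ℂ) 1).tendsto_subseq hu
  have hxlim : Filter.Tendsto (fun n => ‖x (φ n)‖) Filter.atTop (𝓝 0) := by
    have : Filter.Tendsto (fun n => ‖x n‖) Filter.atTop (𝓝 0) :=
      squeeze_zero (fun _ => norm_nonneg _) (fun n => (hxε n).le)
        tendsto_one_div_add_atTop_nhds_zero_nat
    exact this.comp hφ.tendsto_atTop
  refine ⟨v, fun h => by simp [h] at hv, fun t => ?_⟩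
  -- The direction `v` is a limit of the directions of short elements `x`; the multiple `⌊t / ‖x‖⌋ •
  -- x` differs from `t • (x / ‖x‖)` by at most `‖x‖`, so these multiples tend to `t • v`.
  have hmem : ∀ n, (⌊t / ‖x (φ n)‖⌋ : ℤ) • x (φ n) ∈ Λ := fun n => Λ.zsmul_mem (hx _) _
  refine hcl.mem_of_tendsto (b := Filter.atTop) ?_ (Filter.Eventually.of_forall hmem)
  have h1 : Filter.Tendsto (fun n => (⌊t / ‖x (φ n)‖⌋ : ℝ) * ‖x (φ n)‖) Filter.atTop (𝓝 t) := by
    refine tendsto_of_tendsto_of_dist (tendsto_const_nhds (x := t)) (squeeze_zero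
      (fun _ => dist_nonneg) (fun n => ?_) hxlim)
    have hpos : 0 < ‖x (φ n)‖ := norm_pos_iff.2 (hx0 _)
    have e1 : t = (t / ‖x (φ n)‖) * ‖x (φ n)‖ := by field_simp
    rw [Real.dist_eq]
    nth_rewrite 1 [e1]
    rw [← sub_mul, abs_mul, abs_of_pos hpos]
    refine mul_le_of_le_one_left hpos.le ?_
    rw [abs_of_nonneg (by linarith [Int.floor_le (t / ‖x (φ n)‖)])]
    linarith [Int.lt_floor_add_one (t / ‖x (φ n)‖)]
  refine (h1.smul hlim).congr fun n => ?_
  have hne : ‖x (φ n)‖ ≠ 0 := norm_ne_zero_iff.2 (hx0 _)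
  simp only [Function.comp, smul_smul, mul_assoc, mul_inv_cancel₀ hne, mul_one]
  exact Int.cast_smul_eq_zsmul ℝ _ _

variable {S : Type*} [TopologicalSpace S] [T2Space S] {Λ : AddSubgroup ℂ} {D : Set ℂ}
  {o : ℂ → S}

/-- If a quotient of the plane by a closed cocompact subgroup is homeomorphic to the torus,
then the subgroup contains no line. -/
theorem not_line_mem (hcl : IsClosed (Λ : Set ℂ)) (hD : IsCompact D)
    (hDΛ : ∀ z, ∃ d ∈ D, z - d ∈ Λ) (ho : Continuous o) (hos : Function.Surjective o)
    (hoΛ : ∀ z w, o z = o w ↔ z - w ∈ Λ) (e : S ≃ₜ Circle × Circle) {v : ℂ} (hv : v ≠ 0) :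
    ¬ ∀ t : ℝ, t • v ∈ Λ := by
  intro hline
  have hdecomp : ∀ z : ℂ, z = (z / v).re • v + (z / v).im • (Complex.I * v) := fun z => by
    have h := Complex.re_add_im (z / v)
    have : z = ((z / v).re + (z / v).im * Complex.I) * v := by rw [h]; field_simp
    nth_rewrite 1 [this]
    simp only [Complex.real_smul]
    ring
  have hmem : ∀ z, z ∈ Λ ↔ (z / v).im • (Complex.I * v) ∈ Λ := fun z => by
    conv_lhs => rw [hdecomp z]
    exact Λ.add_mem_cancel_left (hline _)
  let L : ℝ →+ ℂ := ((LinearMap.toSpanSingleton ℝ ℂ (Complex.I * v)).toAddMonoidHom)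
  have hL : ∀ t, L t = t • (Complex.I * v) := fun t => rfl
  have hLc : Continuous L := by
    change Continuous fun t : ℝ => t • (Complex.I * v)
    fun_prop
  let Γ : AddSubgroup ℝ := Λ.comap L
  have hΓcl : IsClosed (Γ : Set ℝ) := hcl.preimage hLc
  -- Modulo the line, `Λ` is the closed subgroup `Γ` of `ℝ`. If `Γ = ℝ`, `S` is a point; if `Γ = 0`,
  -- compactness of `D` fails; otherwise `S` is a circle, into which the torus does not inject.
  rcases AddSubgroup.dense_or_cyclic Γ with hdense | ⟨a, ha⟩
  · have htop : ∀ t : ℝ, t • (Complex.I * v) ∈ Λ := fun t => by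
      have : t ∈ closure (Γ : Set ℝ) := hdense t
      rwa [hΓcl.closure_eq] at this
    obtain ⟨z, hz⟩ := hos (e.symm (1, 1))
    obtain ⟨w, hw⟩ := hos (e.symm (1, Circle.exp Real.pi))
    have h1 : o z = o w := (hoΛ z w).2 ((hmem _).2 (htop _))
    have h2 := congrArg Prod.snd (e.symm.injective (hz.symm.trans (h1.trans hw)))
    have h3 := congrArg (fun z : Circle => (z : ℂ)) h2
    simp [Circle.coe_exp] at h3
    norm_num [Complex.ext_iff] at h3
  · rw [← AddSubgroup.zmultiples_eq_closure] at ha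
    by_cases ha0 : a = 0
    · obtain ⟨C, hC⟩ := (hD.image (f := fun z => (z / v).im) (by fun_prop)).isBounded.exists_norm_le
      obtain ⟨d, hd, hdΛ⟩ := hDΛ ((C + 1 : ℝ) • (Complex.I * v))
      have h1 : ((((C + 1 : ℝ) • (Complex.I * v) - d) / v).im) ∈ Γ := (hmem _).1 hdΛ
      rw [ha, ha0] at h1
      simp only [AddSubgroup.zmultiples_zero_eq_bot, AddSubgroup.mem_bot] at h1
      have h2 : ((C + 1 : ℝ) • (Complex.I * v) / v).im = C + 1 := by
        rw [Complex.real_smul, ← mul_assoc, mul_div_cancel_right₀ _ hv]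
        simp
      rw [sub_div, Complex.sub_im, h2] at h1
      have h3 := hC _ ⟨d, hd, rfl⟩
      rw [Real.norm_eq_abs] at h3
      linarith [le_abs_self ((d / v).im)]
    · have : Fact (0 < |a|) := ⟨abs_pos.2 ha0⟩
      have hΓ : ∀ t, t ∈ Γ ↔ t ∈ AddSubgroup.zmultiples |a| := fun t => by
        rw [ha]
        rcases abs_choice a with h | h <;> rw [h]
        rw [AddSubgroup.zmultiples_neg]
      have hper : Function.Periodic (fun t => o (L t)) |a| := fun t => by
        refine (hoΛ _ _).2 ?_
        rw [← map_sub, add_sub_cancel_left]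
        exact (hΓ _).2 (AddSubgroup.mem_zmultiples _)
      let κ : AddCircle |a| → S := hper.lift
      have hκ : Continuous κ := continuous_coinduced_dom.2 (ho.comp hLc)
      have hκb : Function.Bijective κ := by
        constructor
        · intro x y
          induction x using QuotientAddGroup.induction_on with | _ x =>
          induction y using QuotientAddGroup.induction_on with | _ y =>
          intro h
          have h1 : L x - L y ∈ Λ := (hoΛ _ _).1 h
          rw [← map_sub] at h1
          have h2 := (hΓ _).1 h1
          rw [QuotientAddGroup.eq_iff_sub_mem]
          exact h2
        · intro s
          obtain ⟨z, rfl⟩ := hos s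
          refine ⟨((z / v).im : ℝ), (hoΛ _ _).2 ?_⟩
          rw [hL, ← neg_mem_iff, neg_sub]
          nth_rewrite 1 [hdecomp z]
          rw [add_sub_cancel_right]
          exact hline _
      let E := Continuous.homeoOfEquivCompactToT2 (f := Equiv.ofBijective κ hκb) hκ
      exact not_injective_torus_addCircle (E.symm.continuous.comp e.symm.continuous)
        (E.symm.injective.comp e.symm.injective)

/-- A closed cocompact subgroup of the plane with quotient homeomorphic to the torus is the
lattice spanned by a basis. -/
theorem exists_lattice_basis (hcl : IsClosed (Λ : Set ℂ)) (hD : IsCompact D)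
    (hDΛ : ∀ z, ∃ d ∈ D, z - d ∈ Λ) (ho : Continuous o) (hos : Function.Surjective o)
    (hoΛ : ∀ z w, o z = o w ↔ z - w ∈ Λ) (e : S ≃ₜ Circle × Circle) :
    ∃ (ι : Type) (_ : Fintype ι) (b : Module.Basis ι ℝ ℂ),
      Submodule.span ℤ (Set.range b) = AddSubgroup.toIntSubmodule Λ := by
  let M : Submodule ℤ ℂ := AddSubgroup.toIntSubmodule Λ
  have hdisc : DiscreteTopology M := by
    by_contra hnd
    obtain ⟨v, hv, hline⟩ := exists_line_of_accumulating hcl fun ε hε => by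
      by_contra! hcon
      refine hnd (discreteTopology_of_isOpen_singleton_zero ?_)
      refine ⟨Metric.ball 0 ε, Metric.isOpen_ball, ?_⟩
      ext x
      simp only [Set.mem_preimage, Metric.mem_ball, dist_zero_right, Set.mem_singleton_iff]
      refine ⟨fun h => ?_, fun h => by simpa [h] using hε⟩
      by_contra hx0
      exact absurd h (not_lt.2 (hcon x x.2 fun h => hx0 (Subtype.ext h)))
    exact not_line_mem hcl hD hDΛ ho hos hoΛ e hv hline
  have hspan : IsZLattice ℝ M := ⟨by
    by_contra hne
    -- A nonzero functional vanishing on `Λ` would take all its values on the compact set `D`, yet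
    -- it is unbounded.
    obtain ⟨f, hf0, hf⟩ := Submodule.exists_le_ker_of_lt_top _ (lt_top_iff_ne_top.2 hne)
    obtain ⟨z, hz⟩ : ∃ z, f z ≠ 0 := by
      by_contra! hcon
      exact hf0 (LinearMap.ext hcon)
    have hfc : Continuous f := f.continuous_of_finiteDimensional
    obtain ⟨C, hC⟩ := (hD.image hfc).isBounded.exists_norm_le
    obtain ⟨d, hd, hdΛ⟩ := hDΛ (((C + 1) / f z) • z)
    have h1 : f (((C + 1) / f z) • z - d) = 0 := hf (Submodule.subset_span hdΛ)
    rw [map_sub, map_smul, smul_eq_mul, div_mul_cancel₀ _ hz] at h1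
    have h2 := hC _ ⟨d, hd, rfl⟩
    rw [Real.norm_eq_abs] at h2
    linarith [le_abs_self (f d)]⟩
  let b := Module.Free.chooseBasis ℤ M
  exact ⟨_, inferInstance, b.ofZLatticeBasis ℝ M, b.ofZLatticeBasis_span ℝ⟩

end Lattice

/-! ### Characters of a lattice and of the plane -/

section LatticeCharacters

/-- The character `z ↦ exp (i ℓ(z))` of `ℂ` given by a real linear functional `ℓ`. -/
noncomputable def expCharacter (ℓ : ℂ →ₗ[ℝ] ℝ) : Multiplicative ℂ →ₜ* Circle where
  toFun z := Circle.exp (ℓ z.toAdd)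
  map_one' := by simp
  map_mul' z w := by simp [Circle.exp_add]
  continuous_toFun := Circle.exp.continuous.comp
    (ℓ.continuous_of_finiteDimensional.comp continuous_toAdd)

theorem expCharacter_ofAdd (ℓ : ℂ →ₗ[ℝ] ℝ) (z : ℂ) :
    expCharacter ℓ (Multiplicative.ofAdd z) = Circle.exp (ℓ z) := rfl

variable {Λ : AddSubgroup ℂ} {ι : Type*} (b : Module.Basis ι ℝ ℂ)

/-- The characters of a lattice extend to characters of the plane. -/
theorem exists_character_extension
    (hb : Submodule.span ℤ (Set.range b) = AddSubgroup.toIntSubmodule Λ)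
    (φ : Multiplicative Λ →* Circle) :
    ∃ ψ : Multiplicative ℂ →ₜ* Circle,
      ∀ l : Λ, ψ (Multiplicative.ofAdd (l : ℂ)) = φ (Multiplicative.ofAdd l) := by
  have hbΛ : ∀ z, z ∈ Submodule.span ℤ (Set.range b) ↔ z ∈ Λ := fun z => by
    rw [hb]
    rfl
  -- The arguments are logarithms of the prescribed values on the basis; a basis of the lattice is
  -- also a real basis of the plane.
  let ℓ : ℂ →ₗ[ℝ] ℝ := b.constr ℝ fun i =>
    Complex.arg (φ (Multiplicative.ofAdd ⟨b i, (hbΛ _).1 (Submodule.subset_span ⟨i, rfl⟩)⟩))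
  let φ' : Multiplicative Λ →* Circle := (expCharacter ℓ).toMonoidHom.comp
    (AddMonoidHom.toMultiplicative Λ.subtype)
  have key : ∀ z (hz : z ∈ Submodule.span ℤ (Set.range b)),
      φ' (Multiplicative.ofAdd ⟨z, (hbΛ z).1 hz⟩) = φ (Multiplicative.ofAdd ⟨z, (hbΛ z).1 hz⟩) := by
    intro z hz
    induction hz using Submodule.span_induction with
    | mem z hz =>
      obtain ⟨i, rfl⟩ := hz
      change Circle.exp (ℓ (b i)) = _
      rw [Module.Basis.constr_basis, Circle.exp_arg]
    | zero => exact (map_one φ').trans (map_one φ).symm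
    | add x y hx hy ihx ihy =>
      have h := congrArg₂ (· * ·) ihx ihy
      simp only [← map_mul, ← ofAdd_add] at h
      exact h
    | smul k x hx ih =>
      have h := congrArg (· ^ k) ih
      simp only [← map_zpow, ← ofAdd_zsmul] at h
      exact h
  exact ⟨expCharacter ℓ, fun l => key l ((hbΛ l).2 l.2)⟩

/-- A lattice is the common kernel of the characters dual to a basis. -/
theorem mem_lattice_iff_characters
    (hb : Submodule.span ℤ (Set.range b) = AddSubgroup.toIntSubmodule Λ) (z : ℂ) :
    z ∈ Λ ↔ ∀ i, expCharacter ((2 * Real.pi) • b.coord i) (Multiplicative.ofAdd z) = 1 := by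
  have hbΛ : z ∈ Submodule.span ℤ (Set.range b) ↔ z ∈ Λ := by
    rw [hb]
    rfl
  rw [← hbΛ, b.mem_span_iff_repr_mem ℤ z]
  refine forall_congr' fun i => ?_
  rw [expCharacter_ofAdd, Circle.exp_eq_one]
  refine exists_congr fun n => ?_
  simp only [algebraMap_int_eq, eq_intCast, LinearMap.smul_apply, Module.Basis.coord_apply,
    smul_eq_mul]
  rw [mul_comm (n : ℝ), mul_right_inj' Real.two_pi_pos.ne', eq_comm]

end LatticeCharacters

/-! ### Transitivity on a compact set of parameters -/

/-- A transitive continuous action of `ℂ` on a compact space is transitive on a compact set. -/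
theorem exists_isCompact_orbit {S : Type*} [TopologicalSpace S] [CompactSpace S] [T2Space S]
    [AddAction ℂ S] [ContinuousVAdd ℂ S] [AddAction.IsPretransitive ℂ S] (x : S) :
    ∃ D : Set ℂ, IsCompact D ∧ ∀ y : S, ∃ d ∈ D, d +ᵥ x = y := by
  -- The group is σ-compact and the space is Baire, so the orbit map is open and the images of balls
  -- form an open cover.
  have hopen := isOpenMap_vadd_of_sigmaCompact (G := ℂ) x
  obtain ⟨t, ht⟩ := isCompact_univ.elim_finite_subcover
    (fun n : ℕ => (fun z : ℂ => z +ᵥ x) '' Metric.ball 0 n)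
    (fun n => hopen _ Metric.isOpen_ball) fun y _ => by
      obtain ⟨z, rfl⟩ := AddAction.exists_vadd_eq ℂ x y
      obtain ⟨n, hn⟩ := exists_nat_gt ‖z‖
      exact Set.mem_iUnion.2 ⟨n, z, by simpa using hn, rfl⟩
  refine ⟨⋃ n ∈ t, Metric.closedBall 0 n,
    t.isCompact_biUnion fun n _ => isCompact_closedBall _ _, fun y => ?_⟩
  obtain ⟨n, hn, z, hz, rfl⟩ := Set.mem_iUnion₂.1 (ht (Set.mem_univ y))
  exact ⟨z, Set.mem_iUnion₂.2 ⟨n, hn, Metric.ball_subset_closedBall hz⟩, rfl⟩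

/-! ### Principal bundles and the topology of their automorphism groups -/

section PrincipalBundle

variable
    {EG HG EP HP ES HS : Type*}
    [NormedAddCommGroup EG] [NormedSpace ℝ EG] [TopologicalSpace HG]
    [NormedAddCommGroup EP] [NormedSpace ℝ EP] [TopologicalSpace HP]
    [NormedAddCommGroup ES] [NormedSpace ℝ ES] [TopologicalSpace HS]
    {IG : ModelWithCorners ℝ EG HG} {IP : ModelWithCorners ℝ EP HP} {IS : ModelWithCorners ℝ ES HS}
    {G P S : Type*}
    [TopologicalSpace G] [ChartedSpace HG G] [Group G]
    [TopologicalSpace P] [ChartedSpace HP P]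
    [TopologicalSpace S] [ChartedSpace HS S]

namespace SmoothPrincipalBundle

variable (ξ : SmoothPrincipalBundle IG IP IS G P S)

theorem continuous_act : Continuous fun q : P × G => ξ.act q.1 q.2 := ξ.contMDiff_act.continuous

theorem continuous_proj : Continuous ξ.proj := ξ.contMDiff_proj.continuous

theorem act_injective (p : P) : Function.Injective (ξ.act p) := by
  intro g g' h
  obtain ⟨e, hb, -, -, he⟩ := ξ.locally_trivial (ξ.proj p)
  have hp : p ∈ e.source := e.mem_source.2 hb
  have := he p hp g
  rw [h, he p hp g'] at this
  exact (mul_left_cancel this).symm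

theorem exists_act_eq {p q : P} (h : ξ.proj p = ξ.proj q) : ∃ g, ξ.act p g = q := by
  obtain ⟨e, hb, -, -, he⟩ := ξ.locally_trivial (ξ.proj p)
  have hp : p ∈ e.source := e.mem_source.2 hb
  have hq : q ∈ e.source := e.mem_source.2 (h ▸ hb)
  refine ⟨(e p).2⁻¹ * (e q).2, ?_⟩
  have hpg : ξ.act p ((e p).2⁻¹ * (e q).2) ∈ e.source :=
    e.mem_source.2 (by rwa [ξ.proj_act])
  refine e.injOn hpg hq (Prod.ext ?_ ?_)
  · change (e _).1 = (e q).1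
    rw [e.coe_fst hpg, e.coe_fst hq, ξ.proj_act, h]
  · change (e _).2 = (e q).2
    rw [he p hp, mul_inv_cancel_left]

end SmoothPrincipalBundle

namespace BundleAut

variable {ξ : SmoothPrincipalBundle IG IP IS G P S}

@[simp]
theorem one_toDiffeo_apply (p : P) : (1 : BundleAut ξ).toDiffeo p = p := rfl

@[simp]
theorem mul_toDiffeo_apply (f g : BundleAut ξ) (p : P) :
    (f * g).toDiffeo p = f.toDiffeo (g.toDiffeo p) := rfl

@[simp]
theorem one_baseDiffeo_apply (b : S) : (1 : BundleAut ξ).baseDiffeo b = b := rfl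

@[simp]
theorem mul_baseDiffeo_apply (f g : BundleAut ξ) (b : S) :
    (f * g).baseDiffeo b = f.baseDiffeo (g.baseDiffeo b) := rfl

theorem continuous_toContinuousMap :
    Continuous (toContinuousMap : BundleAut ξ → C(P, P)) := continuous_induced_dom

theorem continuous_eval [LocallyCompactSpace P] :
    Continuous fun q : BundleAut ξ × P => q.1.toDiffeo q.2 :=
  ContinuousEval.continuous_eval.comp (continuous_toContinuousMap.prodMap continuous_id)

theorem continuous_of_continuous_eval {X : Type*} [TopologicalSpace X] {f : X → BundleAut ξ}
    (hf : Continuous fun q : X × P => (f q.1).toDiffeo q.2) : Continuous f :=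
  continuous_induced_rng.2
    (ContinuousMap.continuous_of_continuous_uncurry (fun x => (f x).toContinuousMap) hf)

instance [T2Space P] : T2Space (BundleAut ξ) :=
  T2Space.of_injective_continuous
    (fun _ _ h => ext_total fun p => congrArg (fun F : C(P, P) => F p) h)
    continuous_toContinuousMap

/-- The action on the base is continuous. -/
theorem continuous_base_eval [LocallyCompactSpace P] :
    Continuous fun q : BundleAut ξ × S => q.1.baseDiffeo q.2 := by
  refine continuous_iff_continuousAt.2 fun ⟨f, b⟩ => ?_
  obtain ⟨e, hb, -⟩ := ξ.locally_trivial b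
  -- The base map is recovered as `x ↦ π(f(s(x)))` for a local section `s`.
  have hs : ContinuousAt (fun x : S => e.toOpenPartialHomeomorph.symm (x, (1 : G))) b :=
    ContinuousAt.comp (g := e.toOpenPartialHomeomorph.symm) (f := fun x : S => (x, (1 : G)))
      (e.toOpenPartialHomeomorph.symm.continuousAt (e.mem_target.2 hb)) (by fun_prop)
  have h1 : ContinuousAt (fun q : BundleAut ξ × S =>
      ξ.proj (q.1.toDiffeo (e.toOpenPartialHomeomorph.symm (q.2, (1 : G))))) (f, b) :=
    (ξ.continuous_proj.comp continuous_eval).continuousAt.comp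
      (f := fun q : BundleAut ξ × S => (q.1, e.toOpenPartialHomeomorph.symm (q.2, (1 : G))))
      (continuousAt_fst.prodMk (ContinuousAt.comp (x := (f, b)) (f := Prod.snd)
        (g := fun x : S => e.toOpenPartialHomeomorph.symm (x, (1 : G))) hs continuousAt_snd))
  refine h1.congr ?_
  filter_upwards [continuousAt_snd.preimage_mem_nhds (e.open_baseSet.mem_nhds hb)] with q hq
  rw [q.1.covers, e.proj_symm_apply' hq]

end BundleAut

end PrincipalBundle

/-! ### Flow, holonomy and twists -/

section Frame

variable
    {EG HG EP HP ES HS : Type*}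
    [NormedAddCommGroup EG] [NormedSpace ℝ EG] [TopologicalSpace HG]
    [NormedAddCommGroup EP] [NormedSpace ℝ EP] [TopologicalSpace HP]
    [NormedAddCommGroup ES] [NormedSpace ℝ ES] [TopologicalSpace HS]
    {IG : ModelWithCorners ℝ EG HG} {IP : ModelWithCorners ℝ EP HP} {IS : ModelWithCorners ℝ ES HS}
    {G P S : Type*}
    [TopologicalSpace G] [ChartedSpace HG G] [Group G]
    [TopologicalSpace P] [ChartedSpace HP P]
    [TopologicalSpace S] [ChartedSpace HS S]
    {ξ : SmoothPrincipalBundle IG IP IS G P S} {γ : Multiplicative ℂ →ₜ* BundleAut ξ}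

variable (γ) in
/-- The action of `ℂ` on the total space. -/
noncomputable def flow (z : ℂ) (p : P) : P := (γ (Multiplicative.ofAdd z)).toDiffeo p

theorem flow_zero (p : P) : flow γ 0 p = p := by
  rw [flow, ofAdd_zero, map_one, BundleAut.one_toDiffeo_apply]

theorem flow_add (z w : ℂ) (p : P) : flow γ (z + w) p = flow γ z (flow γ w p) := by
  rw [flow, ofAdd_add, map_mul, BundleAut.mul_toDiffeo_apply, flow, flow]

theorem flow_act (z : ℂ) (p : P) (g : G) : flow γ z (ξ.act p g) = ξ.act (flow γ z p) g :=
  BundleAut.map_act _ _ _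

theorem proj_flow (z : ℂ) (p : P) :
    ξ.proj (flow γ z p) = (γ (Multiplicative.ofAdd z)).baseDiffeo (ξ.proj p) :=
  BundleAut.covers _ _

theorem proj_flow_congr (z : ℂ) {p q : P} :
    ξ.proj (flow γ z p) = ξ.proj (flow γ z q) ↔ ξ.proj p = ξ.proj q := by
  rw [proj_flow, proj_flow]
  exact (γ (Multiplicative.ofAdd z)).baseDiffeo.injective.eq_iff

theorem continuous_flow [LocallyCompactSpace P] : Continuous fun q : ℂ × P => flow γ q.1 q.2 :=
  BundleAut.continuous_eval.comp
    ((γ.continuous_toFun.comp continuous_ofAdd).prodMap continuous_id)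

variable (γ) in
/-- The stabilizer of the projection of `p₀`. -/
noncomputable def periodLattice (p₀ : P) : AddSubgroup ℂ where
  carrier := {z | ξ.proj (flow γ z p₀) = ξ.proj p₀}
  zero_mem' := by simp [flow_zero]
  add_mem' := fun {z w} hz hw => by
    change ξ.proj _ = _
    rw [flow_add, ← (hz : ξ.proj _ = _)]
    exact (proj_flow_congr z).2 hw
  neg_mem' := fun {z} hz => by
    change ξ.proj _ = _
    rw [← proj_flow_congr (γ := γ) z, ← flow_add, add_neg_cancel, flow_zero]
    exact (hz : ξ.proj _ = _).symm

variable {p₀ : P}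

theorem mem_periodLattice {z : ℂ} :
    z ∈ periodLattice γ p₀ ↔ ξ.proj (flow γ z p₀) = ξ.proj p₀ := Iff.rfl

theorem proj_flow_eq_iff {z w : ℂ} :
    ξ.proj (flow γ z p₀) = ξ.proj (flow γ w p₀) ↔ z - w ∈ periodLattice γ p₀ := by
  rw [mem_periodLattice, ← proj_flow_congr (γ := γ) w (p := flow γ (z - w) p₀), ← flow_add,
    add_sub_cancel]

theorem exists_holonomy (l : periodLattice γ p₀) : ∃ g, ξ.act p₀ g = flow γ l p₀ :=
  ξ.exists_act_eq (mem_periodLattice.1 l.2).symm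

variable (γ p₀) in
/-- The holonomy homomorphism `h`, determined by `γ(l) p₀ = p₀ · h(l)`. -/
noncomputable def holonomy : Multiplicative (periodLattice γ p₀) →* G :=
  have h : ∀ l, ξ.act p₀ (exists_holonomy l).choose = flow γ (l : periodLattice γ p₀) p₀ :=
    fun l => (exists_holonomy l).choose_spec
  { toFun := fun l => (exists_holonomy l.toAdd).choose
    map_one' := ξ.act_injective p₀ <| by
      rw [h, ξ.act_one]
      exact flow_zero p₀
    map_mul' := fun l m => ξ.act_injective p₀ <| by
      rw [h, ξ.act_mul, h, ← flow_act, h, ← flow_add, toAdd_mul,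
        AddSubgroup.coe_add] }

theorem act_holonomy (l : periodLattice γ p₀) :
    ξ.act p₀ (holonomy γ p₀ (Multiplicative.ofAdd l)) = flow γ l p₀ :=
  (exists_holonomy l).choose_spec

variable (γ p₀) in
/-- The parametrization `(w, g) ↦ γ(w) p₀ · g` of the total space. -/
noncomputable def frameMap (q : ℂ × G) : P := ξ.act (flow γ q.1 p₀) q.2

theorem continuous_frameMap [LocallyCompactSpace P] : Continuous (frameMap γ p₀) :=
  ξ.continuous_act.comp
    ((continuous_flow.comp (continuous_fst.prodMk continuous_const)).prodMk continuous_snd)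

theorem frameMap_surjOn {D : Set ℂ} (hD : ∀ b, ∃ d ∈ D, ξ.proj (flow γ d p₀) = b) (q : P) :
    ∃ d ∈ D, ∃ g, frameMap γ p₀ (d, g) = q := by
  obtain ⟨d, hd, hdq⟩ := hD (ξ.proj q)
  exact ⟨d, hd, ξ.exists_act_eq hdq⟩

theorem IsFrame.exists_proj_flow_eq (hγ : IsFrame γ) (p₀ : P) (b : S) :
    ∃ z, ξ.proj (flow γ z p₀) = b := by
  obtain ⟨z, hz⟩ := hγ (ξ.proj p₀) b
  exact ⟨z, by rw [proj_flow, hz]⟩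

theorem IsFrame.frameMap_surjective (hγ : IsFrame γ) (p₀ : P) :
    Function.Surjective (frameMap γ p₀) := fun q => by
  obtain ⟨d, -, g, h⟩ := frameMap_surjOn (γ := γ) (p₀ := p₀) (D := Set.univ)
    (fun b => let ⟨z, hz⟩ := hγ.exists_proj_flow_eq p₀ b; ⟨z, trivial, hz⟩) q
  exact ⟨_, h⟩

theorem flow_frameMap (z w : ℂ) (g : G) :
    flow γ z (frameMap γ p₀ (w, g)) = frameMap γ p₀ (z + w, g) := by
  rw [frameMap, flow_act, ← flow_add, frameMap]

theorem act_frameMap (w : ℂ) (g g' : G) :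
    ξ.act (frameMap γ p₀ (w, g)) g' = frameMap γ p₀ (w, g * g') :=
  (ξ.act_mul _ _ _).symm

theorem proj_frameMap (w : ℂ) (g : G) :
    ξ.proj (frameMap γ p₀ (w, g)) = ξ.proj (flow γ w p₀) := ξ.proj_act _ _

theorem frameMap_add_period (w : ℂ) (l : periodLattice γ p₀) (g : G) :
    frameMap γ p₀ (w + l, g) =
      frameMap γ p₀ (w, holonomy γ p₀ (Multiplicative.ofAdd l) * g) := by
  rw [frameMap, flow_add, ← act_holonomy, flow_act, ← ξ.act_mul, frameMap]

/-- The fibres of the parametrization are the orbits of the period lattice on `ℂ × G`. Equal values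
have equal projections, which forces the parameters to differ by a period; freeness of the right
action does the rest. -/
theorem frameMap_eq_iff {w w' : ℂ} {g g' : G} :
    frameMap γ p₀ (w, g) = frameMap γ p₀ (w', g') ↔ ∃ l : periodLattice γ p₀,
      w = w' + l ∧ holonomy γ p₀ (Multiplicative.ofAdd l) * g = g' := by
  constructor
  · intro h
    have hl : w - w' ∈ periodLattice γ p₀ := by
      rw [← proj_flow_eq_iff, ← proj_frameMap w g, h, proj_frameMap]
    have hw : w = w' + (⟨w - w', hl⟩ : periodLattice γ p₀) := (add_sub_cancel w' w).symm
    refine ⟨⟨w - w', hl⟩, hw, ?_⟩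
    rw [hw, frameMap_add_period] at h
    exact ξ.act_injective _ h
  · rintro ⟨l, rfl, rfl⟩
    exact frameMap_add_period w' l g

/-- The automorphism `γ(w) p₀ · g ↦ γ(w) p₀ · ηg` for `η` in the centralizer of the holonomy. -/
noncomputable def twist (hγ : IsFrame γ) (p₀ : P) (η : G) (q : P) : P :=
  let x := Function.surjInv (hγ.frameMap_surjective p₀) q
  frameMap γ p₀ (x.1, η * x.2)

variable {hγ : IsFrame γ} {η : G}

/-- Two preimages of a point differ by a period `l`, which acts on `g` by left multiplication with
`h(l)`. Since `η` commutes with `h(l)`, the preimage chosen in the definition is immaterial. -/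
theorem twist_frameMap (hη : ∀ l, Commute η (holonomy γ p₀ l)) (w : ℂ) (g : G) :
    twist hγ p₀ η (frameMap γ p₀ (w, g)) = frameMap γ p₀ (w, η * g) := by
  have key : ∀ x : ℂ × G, frameMap γ p₀ x = frameMap γ p₀ (w, g) →
      frameMap γ p₀ (x.1, η * x.2) = frameMap γ p₀ (w, η * g) := fun x hx => by
    obtain ⟨l, hw, hg⟩ := frameMap_eq_iff.1 hx
    refine frameMap_eq_iff.2 ⟨l, hw, ?_⟩
    rw [← hg, ← mul_assoc, ← (hη _).eq, mul_assoc]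
  exact key _ (Function.surjInv_eq (hγ.frameMap_surjective p₀) _)

theorem proj_twist (hη : ∀ l, Commute η (holonomy γ p₀ l)) (q : P) :
    ξ.proj (twist hγ p₀ η q) = ξ.proj q := by
  obtain ⟨⟨w, g⟩, rfl⟩ := hγ.frameMap_surjective p₀ q
  rw [twist_frameMap hη, proj_frameMap, proj_frameMap]

theorem twist_act (hη : ∀ l, Commute η (holonomy γ p₀ l)) (q : P) (g : G) :
    twist hγ p₀ η (ξ.act q g) = ξ.act (twist hγ p₀ η q) g := by
  obtain ⟨⟨w, g'⟩, rfl⟩ := hγ.frameMap_surjective p₀ q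
  rw [act_frameMap, twist_frameMap hη, twist_frameMap hη, act_frameMap, mul_assoc]

theorem twist_flow (hη : ∀ l, Commute η (holonomy γ p₀ l)) (q : P) (z : ℂ) :
    twist hγ p₀ η (flow γ z q) = flow γ z (twist hγ p₀ η q) := by
  obtain ⟨⟨w, g'⟩, rfl⟩ := hγ.frameMap_surjective p₀ q
  rw [flow_frameMap, twist_frameMap hη, twist_frameMap hη, flow_frameMap]

theorem twist_mul (hη : ∀ l, Commute η (holonomy γ p₀ l))
    {η' : G} (hη' : ∀ l, Commute η' (holonomy γ p₀ l)) (q : P) :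
    twist hγ p₀ (η * η') q = twist hγ p₀ η (twist hγ p₀ η' q) := by
  obtain ⟨⟨w, g'⟩, rfl⟩ := hγ.frameMap_surjective p₀ q
  rw [twist_frameMap hη', twist_frameMap hη, twist_frameMap fun l => (hη l).mul_left (hη' l),
    mul_assoc]

theorem twist_one (q : P) : twist hγ p₀ 1 q = q := by
  obtain ⟨⟨w, g'⟩, rfl⟩ := hγ.frameMap_surjective p₀ q
  rw [twist_frameMap fun l => Commute.one_left _, one_mul]

/-- Twisting by `h(l)` is translation by the period `l`, so these particular twists are
diffeomorphisms although `frameMap` is merely continuous. -/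
theorem twist_holonomy (l : periodLattice γ p₀) (q : P) :
    twist hγ p₀ (holonomy γ p₀ (Multiplicative.ofAdd l)) q = flow γ l q := by
  obtain ⟨⟨w, g'⟩, rfl⟩ := hγ.frameMap_surjective p₀ q
  rw [twist_frameMap fun m => (Commute.all _ _).map _, flow_frameMap, add_comm,
    frameMap_add_period]

variable [IsTopologicalGroup G]

variable (γ p₀) in
/-- The closure of the holonomy group. -/
noncomputable def holonomyClosure : Subgroup G := (holonomy γ p₀).range.topologicalClosure

theorem holonomy_mem (l : Multiplicative (periodLattice γ p₀)) :
    holonomy γ p₀ l ∈ holonomyClosure γ p₀ :=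
  Subgroup.le_topologicalClosure _ ⟨l, rfl⟩

theorem isClosed_holonomyClosure : IsClosed (holonomyClosure γ p₀ : Set G) :=
  Subgroup.isClosed_topologicalClosure _

/-- A closed condition that holds for the holonomies holds on the closure. -/
theorem holonomyClosure_induction {Q : G → Prop} (hQ : IsClosed {g | Q g})
    (h : ∀ l, Q (holonomy γ p₀ l)) {η : G} (hη : η ∈ holonomyClosure γ p₀) : Q η :=
  closure_minimal (s := Set.range (holonomy γ p₀)) (t := {g | Q g})
    (by rintro _ ⟨l, rfl⟩; exact h l) hQ hη

variable [T2Space G]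

theorem commute_of_mem_holonomyClosure (hη : η ∈ holonomyClosure γ p₀)
    (l : Multiplicative (periodLattice γ p₀)) : Commute η (holonomy γ p₀ l) :=
  holonomyClosure_induction (Q := fun η => Commute η (holonomy γ p₀ l))
    (isClosed_eq (by fun_prop) (by fun_prop)) (fun m => (Commute.all _ _).map _) hη

noncomputable instance : CommGroup (holonomyClosure γ p₀) :=
  { (holonomyClosure γ p₀).toGroup with
    mul_comm := fun η η' => Subtype.ext (holonomyClosure_induction (γ := γ) (p₀ := p₀)
      (Q := fun x => (η : G) * x = x * η) (isClosed_eq (by fun_prop) (by fun_prop))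
      (fun l => commute_of_mem_holonomyClosure η.2 l) η'.2) }

/-- The compact space `H × D × G` maps onto `H × P` by a closed map, hence a quotient map, along
which the twist becomes multiplication by `η`. -/
theorem continuous_twist [CompactSpace G] [T2Space P] [LocallyCompactSpace P] {D : Set ℂ}
    (hDc : IsCompact D) (hD : ∀ b, ∃ d ∈ D, ξ.proj (flow γ d p₀) = b) :
    Continuous fun q : holonomyClosure γ p₀ × P => twist hγ p₀ q.1 q.2 := by
  have : CompactSpace D := isCompact_iff_compactSpace.1 hDc
  have : CompactSpace (holonomyClosure γ p₀) :=
    isCompact_iff_compactSpace.1 isClosed_holonomyClosure.isCompact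
  let Ψ : holonomyClosure γ p₀ × (D × G) → holonomyClosure γ p₀ × P := fun x =>
    (x.1, frameMap γ p₀ (x.2.1, x.2.2))
  have hΨ : Continuous Ψ := continuous_fst.prodMk (continuous_frameMap.comp (by fun_prop))
  have hq : Topology.IsQuotientMap Ψ := by
    refine hΨ.isClosedMap.isQuotientMap hΨ fun ⟨η, q⟩ => ?_
    obtain ⟨d, hd, g, rfl⟩ := frameMap_surjOn hD q
    exact ⟨(η, ⟨d, hd⟩, g), rfl⟩
  refine hq.continuous_iff.2 ?_
  have : (fun q : holonomyClosure γ p₀ × P => twist hγ p₀ q.1 q.2) ∘ Ψ =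
      fun x => frameMap γ p₀ (x.2.1, x.1 * x.2.2) :=
    funext fun x => twist_frameMap (hγ := hγ) (commute_of_mem_holonomyClosure x.1.2) _ _
  rw [this]
  exact continuous_frameMap.comp (by fun_prop)

end Frame

/-! ### Smoothness of the twists -/

/-- Smoothness of a continuous map into a Lie group can be tested in a representation that has
a smooth local left inverse. -/
theorem IsImmersiveRep.contMDiffAt
    {V : Type*} [NormedAddCommGroup V] [InnerProductSpace ℂ V]
    {EG HG G : Type*} [NormedAddCommGroup EG] [NormedSpace ℝ EG] [TopologicalSpace HG]
    {IG : ModelWithCorners ℝ EG HG} [TopologicalSpace G] [ChartedSpace HG G] [Group G]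
    [LieGroup IG ∞ G]
    {E H M : Type*} [NormedAddCommGroup E] [NormedSpace ℝ E] [TopologicalSpace H]
    {I : ModelWithCorners ℝ E H} [TopologicalSpace M] [ChartedSpace H M]
    {ρ : G →* (V →L[ℂ] V)} (hρ : IsImmersiveRep IG ρ) {f : M → G} {x : M}
    (hf : ContinuousAt f x)
    (hρf : ContMDiffAt I 𝓘(ℝ, V →L[ℂ] V) ∞ (fun y => ρ (f y)) x) :
    ContMDiffAt I IG ∞ f x := by
  have : IsTopologicalGroup G := topologicalGroup_of_lieGroup IG ∞
  obtain ⟨r, hr, hrρ⟩ := hρ.exists_leftInverse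
  -- The left inverse of `ρ` exists only near the identity, so `f` is first translated to take the
  -- value `1` at `x`.
  have h1 : ContMDiffAt I 𝓘(ℝ, V →L[ℂ] V) ∞ (fun y => ρ (f x)⁻¹ * ρ (f y)) x := by
    have hL : ContDiff ℝ ∞ fun T : V →L[ℂ] V => ρ (f x)⁻¹ * T :=
      ((ContinuousLinearMap.mul ℂ (V →L[ℂ] V) (ρ (f x)⁻¹)).restrictScalars ℝ).contDiff
    exact hL.contMDiff.contMDiffAt.comp x hρf
  have h2 : ContMDiffAt I IG ∞ (fun y => f x * r (ρ (f x)⁻¹ * ρ (f y))) x := by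
    refine contMDiffAt_const.mul (ContMDiffAt.comp x ?_ h1)
    rwa [← map_mul, inv_mul_cancel, map_one]
  refine h2.congr_of_eventuallyEq ?_
  have h3 : Filter.Tendsto (fun y => (f x)⁻¹ * f y) (𝓝 x) (𝓝 1) := by
    have := (continuous_const_mul (f x)⁻¹).continuousAt.tendsto.comp hf
    rwa [inv_mul_cancel] at this
  filter_upwards [h3.eventually hrρ] with y hy
  rw [← map_mul, hy, mul_inv_cancel_left]

section Frame

variable
    {EG HG EP HP ES HS : Type*}
    [NormedAddCommGroup EG] [NormedSpace ℝ EG] [TopologicalSpace HG]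
    [NormedAddCommGroup EP] [NormedSpace ℝ EP] [TopologicalSpace HP]
    [NormedAddCommGroup ES] [NormedSpace ℝ ES] [TopologicalSpace HS]
    {IG : ModelWithCorners ℝ EG HG} {IP : ModelWithCorners ℝ EP HP} {IS : ModelWithCorners ℝ ES HS}
    {G P S : Type*}
    [TopologicalSpace G] [ChartedSpace HG G] [Group G] [IsTopologicalGroup G]
    [TopologicalSpace P] [ChartedSpace HP P]
    [TopologicalSpace S] [ChartedSpace HS S]
    {ξ : SmoothPrincipalBundle IG IP IS G P S} {γ : Multiplicative ℂ →ₜ* BundleAut ξ}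
    {p₀ : P} {hγ : IsFrame γ} {η : G}
    {V : Type*} [NormedAddCommGroup V] [InnerProductSpace ℂ V] [FiniteDimensional ℂ V]
    {ρ : G →* (V →L[ℂ] V)}

/-- Subspaces of a finite-dimensional space are closed, so membership survives passage to the
closure. Limits of holonomies thereby become finite linear combinations. -/
theorem rep_mem_span_holonomy (hρ : Continuous ρ) (hη : η ∈ holonomyClosure γ p₀) :
    ρ η ∈ Submodule.span ℂ (Set.range fun l => ρ (holonomy γ p₀ l)) := by
  refine holonomyClosure_induction (γ := γ) (p₀ := p₀) (Q := fun η => ρ η ∈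
    Submodule.span ℂ (Set.range fun l => ρ (holonomy γ p₀ l))) ?_
    (fun l => Submodule.subset_span ⟨l, rfl⟩) hη
  exact (Submodule.closed_of_finiteDimensional
    (Submodule.span ℂ (Set.range fun l => ρ (holonomy γ p₀ l)))).preimage hρ

variable [LieGroup IG ∞ G] [T2Space G]

/-- In a local trivialization, the twist by `η` is left multiplication by a smooth function. -/
theorem contMDiffOn_twist_coordinate (hρ : IsImmersiveRep IG ρ)
    (hη : η ∈ holonomyClosure γ p₀) (hc : Continuous (twist hγ p₀ η))
    (e : Bundle.Trivialization G ξ.proj)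
    (he : ContMDiffOn IP (IS.prod IG) ∞ e e.source)
    (hes : ContMDiffOn (IS.prod IG) IP ∞ e.toOpenPartialHomeomorph.symm e.target)
    (hequi : ∀ p ∈ e.source, ∀ g : G, (e (ξ.act p g)).2 = (e p).2 * g) :
    ContMDiffOn IS IG ∞
      (fun x => (e (twist hγ p₀ η (e.toOpenPartialHomeomorph.symm (x, 1)))).2) e.baseSet := by
  let s : S → P := fun x => e.toOpenPartialHomeomorph.symm (x, 1)
  have hs : ContMDiffOn IS IP ∞ s e.baseSet :=
    hes.comp (contMDiff_id.prodMk contMDiff_const).contMDiffOn fun x hx => e.mem_target.2 hx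
  have hproj : ∀ x ∈ e.baseSet, ξ.proj (s x) = x := fun x hx => e.proj_symm_apply' hx
  have hsrc : ∀ x ∈ e.baseSet, s x ∈ e.source := fun x hx =>
    e.mem_source.2 ((hproj x hx).symm ▸ hx)
  have hes1 : ∀ x ∈ e.baseSet, (e (s x)).2 = 1 := fun x hx => by
    rw [e.apply_symm_apply' hx]
  -- No regularity in `x` is required of `A`; it enters only through the conjugates `(A x).2⁻¹ * η'
  -- * (A x).2`, which are the coordinates of the twisted section.
  choose A hA using fun x => hγ.frameMap_surjective p₀ (s x)
  have hconj : ∀ η', (∀ l, Commute η' (holonomy γ p₀ l)) → ∀ x ∈ e.baseSet,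
      (e (twist hγ p₀ η' (s x))).2 = (A x).2⁻¹ * η' * (A x).2 := fun η' hη' x hx => by
    have h1 : twist hγ p₀ η' (s x) = ξ.act (s x) ((A x).2⁻¹ * η' * (A x).2) := by
      rw [← hA x]
      change twist hγ p₀ η' (frameMap γ p₀ ((A x).1, (A x).2)) =
        ξ.act (frameMap γ p₀ ((A x).1, (A x).2)) _
      rw [twist_frameMap hη', act_frameMap, mul_assoc, mul_inv_cancel_left]
    rw [h1, hequi _ (hsrc x hx), hes1 x hx, one_mul]
  -- For `T = ρ(h(l))` the conjugate is the coordinate of the smooth map `γ(l)`; the expression is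
  -- linear in `T`, so smoothness extends to the span.
  have hspan : ∀ T ∈ Submodule.span ℂ (Set.range fun l => ρ (holonomy γ p₀ l)),
      ContMDiffOn IS 𝓘(ℝ, V →L[ℂ] V) ∞ (fun x => ρ (A x).2⁻¹ * T * ρ (A x).2) e.baseSet := by
    intro T hT
    induction hT using Submodule.span_induction with
    | mem T hT =>
      obtain ⟨l, rfl⟩ := hT
      have h1 : ContMDiffOn IS IG ∞ (fun x => (e (flow γ l.toAdd (s x))).2) e.baseSet :=
        ContMDiffOn.comp (t := e.source) (contMDiff_snd.comp_contMDiffOn he)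
          ((BundleAut.toDiffeo (γ (Multiplicative.ofAdd (l.toAdd : ℂ)))).contMDiff.comp_contMDiffOn
            hs) fun x hx => by
              change flow γ l.toAdd (s x) ∈ e.source
              rw [← twist_holonomy (hγ := hγ), e.mem_source,
                proj_twist fun m => (Commute.all _ _).map _, hproj x hx]
              exact hx
      refine (hρ.smooth.comp_contMDiffOn h1).congr fun x hx => ?_
      rw [← map_mul, ← map_mul, Function.comp_apply, ← twist_holonomy (hγ := hγ),
        hconj _ (fun m => (Commute.all _ _).map _) x hx]
      rfl
    | zero => simpa using contMDiffOn_const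
    | add T T' _ _ ih ih' => exact (ih.add ih').congr fun x _ => by simp [mul_add, add_mul]
    | smul c T _ ih =>
      have hL : ContDiff ℝ ∞ fun T : V →L[ℂ] V => c • T :=
        ((c • ContinuousLinearMap.id ℂ (V →L[ℂ] V)).restrictScalars ℝ).contDiff
      simpa [Function.comp_def] using hL.contMDiff.comp_contMDiffOn ih
  have hcomm := commute_of_mem_holonomyClosure hη
  intro x hx
  have hnhds : e.baseSet ∈ 𝓝 x := e.open_baseSet.mem_nhds hx
  refine (hρ.contMDiffAt ?_ ?_).contMDiffWithinAt
  · have h1 : ContinuousAt e (twist hγ p₀ η (s x)) :=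
      e.toOpenPartialHomeomorph.continuousAt
        (e.mem_source.2 (by rw [proj_twist hcomm, hproj x hx]; exact hx))
    exact (continuousAt_snd.comp h1).comp (f := fun x => twist hγ p₀ η (s x))
      (hc.continuousAt.comp (hs.continuousOn.continuousAt hnhds))
  · refine ((hspan _ (rep_mem_span_holonomy hρ.smooth.continuous hη)).congr
      fun y hy => ?_).contMDiffAt hnhds
    change ρ (e (twist hγ p₀ η (s y))).2 = _
    rw [hconj η hcomm y hy, map_mul, map_mul]

/-- The twist commutes with the right action, so locally it is determined by its effect on a
section: `s(x) · g ↦ s(x) · a(x) · g` with `a` the smooth coordinate found above. -/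
theorem contMDiff_twist (hρ : IsImmersiveRep IG ρ)
    (hη : η ∈ holonomyClosure γ p₀) (hc : Continuous (twist hγ p₀ η)) :
    ContMDiff IP IP ∞ (twist hγ p₀ η) := by
  intro q
  have hcomm := commute_of_mem_holonomyClosure hη
  obtain ⟨e, hq, he, hes, hequi⟩ := ξ.locally_trivial (ξ.proj q)
  have hproj : ∀ x ∈ e.baseSet, ξ.proj (e.toOpenPartialHomeomorph.symm (x, 1)) = x :=
    fun x hx => e.proj_symm_apply' hx
  have hs : ContMDiffOn IS IP ∞ (fun x => e.toOpenPartialHomeomorph.symm (x, 1)) e.baseSet :=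
    hes.comp (contMDiff_id.prodMk contMDiff_const).contMDiffOn fun x hx => e.mem_target.2 hx
  have ha := contMDiffOn_twist_coordinate hρ hη hc e he hes hequi
  have hmaps : Set.MapsTo ξ.proj e.source e.baseSet := fun p hp => e.mem_source.1 hp
  have hfac : ContMDiffOn IP IP ∞ (fun p => ξ.act
      (ξ.act (e.toOpenPartialHomeomorph.symm (ξ.proj p, 1))
        (e (twist hγ p₀ η (e.toOpenPartialHomeomorph.symm (ξ.proj p, 1)))).2) (e p).2)
      e.source :=
    ξ.contMDiff_act.comp_contMDiffOn
      ((ξ.contMDiff_act.comp_contMDiffOn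
        ((hs.comp ξ.contMDiff_proj.contMDiffOn hmaps).prodMk
          (ha.comp ξ.contMDiff_proj.contMDiffOn hmaps))).prodMk
        (contMDiff_snd.comp_contMDiffOn he))
  refine (hfac.congr fun p hp => ?_).contMDiffAt
    (e.open_source.mem_nhds (e.mem_source.2 hq))
  have hb : ξ.proj p ∈ e.baseSet := e.mem_source.1 hp
  have key : ∀ p' ∈ e.source, p' =
      ξ.act (e.toOpenPartialHomeomorph.symm (ξ.proj p', 1)) (e p').2 := fun p' hp' => by
    have hb' := e.mem_source.1 hp'
    obtain ⟨g, hg⟩ := ξ.exists_act_eq (hproj _ hb')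
    have h1 := hequi (e.toOpenPartialHomeomorph.symm (ξ.proj p', 1))
      (e.mem_source.2 ((hproj _ hb').symm ▸ hb')) g
    rw [hg, e.apply_symm_apply' hb', one_mul] at h1
    rw [h1, hg]
  have h2 := key (twist hγ p₀ η (e.toOpenPartialHomeomorph.symm (ξ.proj p, 1)))
    (e.mem_source.2 (by rw [proj_twist hcomm, hproj _ hb]; exact hb))
  rw [proj_twist hcomm, hproj _ hb] at h2
  rw [← h2, ← twist_act hcomm, ← key p hp]

end Frame

/-! ### The homomorphism from `ℂ × H` and its characters -/

section Frame

variable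
    {EG HG EP HP ES HS : Type*}
    [NormedAddCommGroup EG] [NormedSpace ℝ EG] [TopologicalSpace HG]
    [NormedAddCommGroup EP] [NormedSpace ℝ EP] [TopologicalSpace HP]
    [NormedAddCommGroup ES] [NormedSpace ℝ ES] [TopologicalSpace HS]
    {IG : ModelWithCorners ℝ EG HG} {IP : ModelWithCorners ℝ EP HP} {IS : ModelWithCorners ℝ ES HS}
    {G P S : Type*}
    [TopologicalSpace G] [ChartedSpace HG G] [Group G] [IsTopologicalGroup G] [T2Space G]
    [TopologicalSpace P] [ChartedSpace HP P]
    [TopologicalSpace S] [ChartedSpace HS S]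
    {ξ : SmoothPrincipalBundle IG IP IS G P S} {γ : Multiplicative ℂ →ₜ* BundleAut ξ}
    {p₀ : P} {hγ : IsFrame γ}

/-- The twist as a bundle automorphism. -/
noncomputable def twistAut
    (hsm : ∀ η ∈ holonomyClosure γ p₀, ContMDiff IP IP ∞ (twist hγ p₀ η))
    (η : holonomyClosure γ p₀) : BundleAut ξ where
  toDiffeo :=
    { toFun := twist hγ p₀ η
      invFun := twist hγ p₀ (η⁻¹ : holonomyClosure γ p₀)
      left_inv := fun q => by
        rw [← twist_mul (commute_of_mem_holonomyClosure (η⁻¹).2)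
          (commute_of_mem_holonomyClosure η.2), ← Subgroup.coe_mul, inv_mul_cancel,
          Subgroup.coe_one, twist_one]
      right_inv := fun q => by
        rw [← twist_mul (commute_of_mem_holonomyClosure η.2)
          (commute_of_mem_holonomyClosure (η⁻¹).2), ← Subgroup.coe_mul, mul_inv_cancel,
          Subgroup.coe_one, twist_one]
      contMDiff_toFun := hsm _ η.2
      contMDiff_invFun := hsm _ (η⁻¹).2 }
  baseDiffeo := Diffeomorph.refl IS S ∞
  map_act := twist_act (hγ := hγ) (commute_of_mem_holonomyClosure η.2)
  covers := proj_twist (hγ := hγ) (commute_of_mem_holonomyClosure η.2)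

theorem twistAut_apply (hsm : ∀ η ∈ holonomyClosure γ p₀, ContMDiff IP IP ∞ (twist hγ p₀ η))
    (η : holonomyClosure γ p₀) (q : P) : (twistAut hsm η).toDiffeo q = twist hγ p₀ η q := rfl

/-- The homomorphism `(z, η) ↦ γ(z) φ_η`, where `φ_η` is the twist by `η`. -/
noncomputable def frameHom [LocallyCompactSpace P]
    (hsm : ∀ η ∈ holonomyClosure γ p₀, ContMDiff IP IP ∞ (twist hγ p₀ η))
    (hc : Continuous fun q : holonomyClosure γ p₀ × P => twist hγ p₀ q.1 q.2) :
    Multiplicative ℂ × holonomyClosure γ p₀ →ₜ* BundleAut ξ where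
  toFun x := γ x.1 * twistAut hsm x.2
  map_one' := BundleAut.ext_total fun q => by
    rw [Prod.fst_one, map_one, one_mul, twistAut_apply]
    exact twist_one q
  map_mul' x y := BundleAut.ext_total fun q => by
    simp only [BundleAut.mul_toDiffeo_apply, twistAut_apply, Prod.fst_mul, Prod.snd_mul, map_mul]
    refine congrArg _ ?_
    rw [Subgroup.coe_mul, twist_mul (commute_of_mem_holonomyClosure x.2.2)
      (commute_of_mem_holonomyClosure y.2.2)]
    exact (twist_flow (commute_of_mem_holonomyClosure x.2.2) _ _).symm
  continuous_toFun := BundleAut.continuous_of_continuous_eval <|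
    (continuous_flow (γ := γ)).comp (((continuous_toAdd.comp continuous_fst).comp
      continuous_fst).prodMk (hc.comp ((continuous_snd.comp continuous_fst).prodMk continuous_snd)))

variable [LocallyCompactSpace P]
    {hsm : ∀ η ∈ holonomyClosure γ p₀, ContMDiff IP IP ∞ (twist hγ p₀ η)}
    {hc : Continuous fun q : holonomyClosure γ p₀ × P => twist hγ p₀ q.1 q.2}

theorem frameHom_apply_frameMap (x : Multiplicative ℂ × holonomyClosure γ p₀) (w : ℂ) (g : G) :
    (frameHom hsm hc x).toDiffeo (frameMap γ p₀ (w, g)) =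
      frameMap γ p₀ (x.1.toAdd + w, x.2 * g) := by
  change flow γ x.1.toAdd (twist hγ p₀ x.2 (frameMap γ p₀ (w, g))) = _
  rw [twist_frameMap (commute_of_mem_holonomyClosure x.2.2), flow_frameMap]

theorem frameHom_mk_one (z : Multiplicative ℂ) : frameHom hsm hc (z, 1) = γ z :=
  BundleAut.ext_total fun q => congrArg _ (twist_one (hγ := hγ) q)

/-- An automorphism in the image is determined by its value at `p₀ = frameMap (0, 1)`. The kernel is
the graph of `l ↦ h(l)⁻¹`, so the image is algebraically `(ℂ × H)/Λ`. -/
theorem frameHom_eq_one_iff {x : Multiplicative ℂ × holonomyClosure γ p₀} :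
    frameHom hsm hc x = 1 ↔ ∃ l : periodLattice γ p₀,
      x.1 = Multiplicative.ofAdd (l : ℂ) ∧
        holonomy γ p₀ (Multiplicative.ofAdd l) * (x.2 : G) = 1 := by
  constructor
  · intro h
    have h1 := frameHom_apply_frameMap (hsm := hsm) (hc := hc) x 0 1
    rw [h, BundleAut.one_toDiffeo_apply] at h1
    obtain ⟨l, hl, hl'⟩ := frameMap_eq_iff.1 h1.symm
    rw [add_zero, zero_add] at hl
    rw [mul_one] at hl'
    exact ⟨l, hl, hl'⟩
  · rintro ⟨l, hl, hl'⟩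
    refine BundleAut.ext_total fun q => ?_
    obtain ⟨⟨w, g⟩, rfl⟩ := hγ.frameMap_surjective p₀ q
    rw [frameHom_apply_frameMap, hl, toAdd_ofAdd, add_comm, frameMap_add_period, ← mul_assoc, hl',
      one_mul, BundleAut.one_toDiffeo_apply]

theorem frameHom_period (l : periodLattice γ p₀) :
    frameHom hsm hc (Multiplicative.ofAdd (l : ℂ),
      ⟨holonomy γ p₀ (Multiplicative.ofAdd l), holonomy_mem _⟩⁻¹) = 1 :=
  frameHom_eq_one_iff.2 ⟨l, rfl, mul_inv_cancel _⟩

/-- A kernel element moves the first coordinate into `D`; for compact `D` and `H` this makes the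
image compact. -/
theorem exists_frameHom_eq {D : Set ℂ} (hD : ∀ b, ∃ d ∈ D, ξ.proj (flow γ d p₀) = b)
    (x : Multiplicative ℂ × holonomyClosure γ p₀) :
    ∃ y ∈ (Multiplicative.toAdd ⁻¹' D) ×ˢ (Set.univ : Set (holonomyClosure γ p₀)),
      frameHom hsm hc y = frameHom hsm hc x := by
  obtain ⟨d, hd, hdx⟩ := hD (ξ.proj (flow γ x.1.toAdd p₀))
  let l : periodLattice γ p₀ := ⟨d - x.1.toAdd, proj_flow_eq_iff.1 hdx⟩
  refine ⟨(Multiplicative.ofAdd (l : ℂ),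
    ⟨holonomy γ p₀ (Multiplicative.ofAdd l), holonomy_mem _⟩⁻¹) * x, ⟨?_, trivial⟩, ?_⟩
  · change d - x.1.toAdd + x.1.toAdd ∈ D
    rwa [sub_add_cancel]
  · rw [map_mul, frameHom_period, one_mul]

/-- The characters of `ℂ × H` that are trivial on the kernel of `frameHom` are torsion free. -/
theorem character_eq_one_of_zpow_eq_one
    (χ : (Multiplicative ℂ × holonomyClosure γ p₀) →ₜ* Circle)
    (hχ : ∀ x, frameHom hsm hc x = 1 → χ x = 1) {k : ℤ} (hk : k ≠ 0) (hχk : χ ^ k = 1) :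
    χ = 1 := by
  -- Divisibility of `ℂ`: every `z` is a `k`-th power, and `χ ^ k` is trivial.
  have h1 : ∀ z : Multiplicative ℂ, χ (z, 1) = 1 := fun z => by
    have hz : (z, (1 : holonomyClosure γ p₀)) =
        (Multiplicative.ofAdd (z.toAdd / k : ℂ), (1 : holonomyClosure γ p₀)) ^ k := by
      refine Prod.ext ?_ (one_zpow k).symm
      change z = Multiplicative.ofAdd (z.toAdd / k : ℂ) ^ k
      rw [← ofAdd_zsmul, zsmul_eq_mul, mul_div_cancel₀ _ (Int.cast_ne_zero.2 hk), ofAdd_toAdd]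
    rw [hz, map_zpow, ← evalCharacter_apply, ← map_zpow, hχk, map_one]
  -- The kernel element `(l, h(l)⁻¹)` carries triviality from `ℂ` over to the holonomies.
  have h2 : ∀ l, χ (1, ⟨holonomy γ p₀ l, holonomy_mem l⟩) = 1 := fun l => by
    have h3 := hχ _ (frameHom_period (hsm := hsm) (hc := hc) l.toAdd)
    rw [← inv_inj, inv_one, ← map_inv]
    rw [← mul_one (Multiplicative.ofAdd _), ← one_mul (_⁻¹ : holonomyClosure γ p₀),
      ← Prod.mk_mul_mk, map_mul, h1, one_mul] at h3
    simpa using h3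
  have h4 : ∀ η : holonomyClosure γ p₀, χ (1, η) = 1 := by
    have hcl : IsClosed {η : holonomyClosure γ p₀ | χ (1, η) = 1} :=
      isClosed_eq (χ.continuous_toFun.comp (by fun_prop)) continuous_const
    have hcl' := isClosed_holonomyClosure (γ := γ) (p₀ := p₀) |>.isClosedMap_subtype_val _ hcl
    intro η
    have h5 := holonomyClosure_induction (γ := γ) (p₀ := p₀)
      (Q := fun g => g ∈ Subtype.val '' {η : holonomyClosure γ p₀ | χ (1, η) = 1})
      hcl' (fun l => ⟨_, h2 l, rfl⟩) η.2
    obtain ⟨η', hη', h⟩ := h5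
    rwa [← Subtype.ext h]
  ext ⟨z, η⟩ : 1
  rw [← mul_one z, ← one_mul η, ← Prod.mk_mul_mk, map_mul, h1, h4, one_mul]
  rfl

/-- The kernel of `frameHom` is the common kernel of finitely many characters. -/
theorem exists_characters_frameHom {ι : Type*} [Finite ι] (b : Module.Basis ι ℝ ℂ)
    (hb : Submodule.span ℤ (Set.range b) = AddSubgroup.toIntSubmodule (periodLattice γ p₀))
    {s : Set (holonomyClosure γ p₀ →ₜ* Circle)} (hs : s.Finite)
    (hsep : ∀ η, (∀ χ ∈ s, χ η = 1) → η = 1) :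
    ∃ t : Set ((Multiplicative ℂ × holonomyClosure γ p₀) →ₜ* Circle), t.Finite ∧
      ∀ x, frameHom hsm hc x = 1 ↔ ∀ χ ∈ t, χ x = 1 := by
  let h' : Multiplicative (periodLattice γ p₀) →* holonomyClosure γ p₀ :=
    (holonomy γ p₀).codRestrict _ holonomy_mem
  -- For each `χ`, `χ ∘ h` extends from the lattice to a character `ψ` of `ℂ`. Then `ψ(z)χ(η)`
  -- equals `χ(h(l)η)` at `(l, η)`, so it is trivial on the kernel. Conversely, the characters `Y`
  -- force `z` into the lattice and the characters `X χ` with `χ ∈ s` then force `h(l)η = 1`.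
  choose ψ hψ using fun χ : holonomyClosure γ p₀ →ₜ* Circle =>
    exists_character_extension b hb (χ.toMonoidHom.comp h')
  let X : (holonomyClosure γ p₀ →ₜ* Circle) →
      ((Multiplicative ℂ × holonomyClosure γ p₀) →ₜ* Circle) := fun χ =>
    (ψ χ).comp (ContinuousMonoidHom.fst _ _) * χ.comp (ContinuousMonoidHom.snd _ _)
  let Y : ι → ((Multiplicative ℂ × holonomyClosure γ p₀) →ₜ* Circle) := fun i =>
    (expCharacter ((2 * Real.pi) • b.coord i)).comp (ContinuousMonoidHom.fst _ _)
  have hX : ∀ χ (l : periodLattice γ p₀) (η : holonomyClosure γ p₀),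
      X χ (Multiplicative.ofAdd (l : ℂ), η) = χ (h' (Multiplicative.ofAdd l) * η) :=
    fun χ l η => by
      rw [map_mul]
      exact congrArg (· * χ η) (hψ χ l)
  refine ⟨X '' s ∪ Set.range Y, (hs.image X).union (Set.finite_range Y), fun x => ?_⟩
  rw [frameHom_eq_one_iff]
  constructor
  · rintro ⟨l, hl, hl'⟩ χ (⟨χ, hχ, rfl⟩ | ⟨i, rfl⟩)
    · rw [← Prod.mk.eta (p := x), hl, hX]
      have : h' (Multiplicative.ofAdd l) * x.2 = 1 := Subtype.ext hl'
      rw [this, map_one]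
    · change expCharacter _ x.1 = 1
      rw [hl]
      exact (mem_lattice_iff_characters b hb _).1 l.2 i
  · intro h
    have hz : x.1.toAdd ∈ periodLattice γ p₀ :=
      (mem_lattice_iff_characters b hb _).2 fun i => h _ (Or.inr ⟨i, rfl⟩)
    refine ⟨⟨_, hz⟩, rfl, ?_⟩
    refine congrArg Subtype.val (hsep (h' (Multiplicative.ofAdd ⟨_, hz⟩) * x.2) fun χ hχ => ?_)
    rw [← hX]
    exact h _ (Or.inl ⟨χ, hχ, rfl⟩)

end Frame

/-! ### Compactness of the image and the main theorem -/

/-- A frame over a compact base is transitive on a compact set of parameters. -/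
theorem IsFrame.exists_isCompact
    {EG HG EP HP ES HS : Type*}
    [NormedAddCommGroup EG] [NormedSpace ℝ EG] [TopologicalSpace HG]
    [NormedAddCommGroup EP] [NormedSpace ℝ EP] [TopologicalSpace HP]
    [NormedAddCommGroup ES] [NormedSpace ℝ ES] [TopologicalSpace HS]
    {IG : ModelWithCorners ℝ EG HG} {IP : ModelWithCorners ℝ EP HP} {IS : ModelWithCorners ℝ ES HS}
    {G P S : Type*}
    [TopologicalSpace G] [ChartedSpace HG G] [Group G]
    [TopologicalSpace P] [ChartedSpace HP P] [LocallyCompactSpace P]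
    [TopologicalSpace S] [ChartedSpace HS S] [CompactSpace S] [T2Space S]
    {ξ : SmoothPrincipalBundle IG IP IS G P S} {γ : Multiplicative ℂ →ₜ* BundleAut ξ}
    (hγ : IsFrame γ) (p₀ : P) :
    ∃ D : Set ℂ, IsCompact D ∧ ∀ b, ∃ d ∈ D, ξ.proj (flow γ d p₀) = b := by
  let _ : AddAction ℂ S :=
    { vadd := fun z b => (γ (Multiplicative.ofAdd z)).baseDiffeo b
      zero_vadd := fun b => by
        change (γ (Multiplicative.ofAdd 0)).baseDiffeo b = b
        rw [ofAdd_zero, map_one, BundleAut.one_baseDiffeo_apply]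
      add_vadd := fun z w b => by
        change (γ (Multiplicative.ofAdd (z + w))).baseDiffeo b = _
        rw [ofAdd_add, map_mul, BundleAut.mul_baseDiffeo_apply]
        rfl }
  have : ContinuousVAdd ℂ S := ⟨BundleAut.continuous_base_eval.comp
    ((γ.continuous_toFun.comp continuous_ofAdd).prodMap continuous_id)⟩
  have : AddAction.IsPretransitive ℂ S := ⟨hγ⟩
  obtain ⟨D, hD, h⟩ := exists_isCompact_orbit (ξ.proj p₀)
  exact ⟨D, hD, fun b => let ⟨d, hd, hdb⟩ := h b; ⟨d, hd, (proj_flow d p₀).trans hdb⟩⟩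

theorem mainTheorem10
    {EG HG EP HP ES HS : Type*}
    [NormedAddCommGroup EG] [NormedSpace ℝ EG] [FiniteDimensional ℝ EG] [TopologicalSpace HG]
    [NormedAddCommGroup EP] [NormedSpace ℝ EP] [FiniteDimensional ℝ EP] [TopologicalSpace HP]
    [NormedAddCommGroup ES] [NormedSpace ℝ ES] [FiniteDimensional ℝ ES] [TopologicalSpace HS]
    (IG : ModelWithCorners ℝ EG HG) [IG.Boundaryless]
    (IP : ModelWithCorners ℝ EP HP) [IP.Boundaryless]
    (IS : ModelWithCorners ℝ ES HS) [IS.Boundaryless]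
    {G P S : Type*}
    [TopologicalSpace G] [ChartedSpace HG G] [Group G] [LieGroup IG ∞ G]
    [CompactSpace G] [T2Space G]
    [TopologicalSpace P] [ChartedSpace HP P] [IsManifold IP ∞ P] [T2Space P]
    [TopologicalSpace S] [ChartedSpace HS S]
    (hS : IsGenusOneSurface IS S)
    (ξ : SmoothPrincipalBundle IG IP IS G P S)
    (γ : Multiplicative ℂ →ₜ* BundleAut ξ) (hγ : IsFrame γ) :
    IsCompact (closure (Set.range γ)) ∧
      ∃ T : Subgroup (BundleAut ξ), IsClosed (T : Set (BundleAut ξ)) ∧ IsTorusGroup T ∧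
        ∃ γT : Multiplicative ℂ →ₜ* T, ∀ z, (γT z : BundleAut ξ) = γ z := by
  have : IsTopologicalGroup G := topologicalGroup_of_lieGroup IG ∞
  have : LocallyCompactSpace P := Manifold.locallyCompact_of_finiteDimensional IP
  obtain ⟨-, ⟨e⟩⟩ := hS
  let e' : S ≃ₜ Circle × Circle := e.toHomeomorph
  have : CompactSpace S := e'.symm.compactSpace
  have : T2Space S := e'.symm.t2Space
  obtain ⟨p₀, -⟩ := BundleAut.proj_surjective ξ (e'.symm (1, 1))
  obtain ⟨D, hDc, hD⟩ := hγ.exists_isCompact p₀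
  obtain ⟨V, _, _, _, ρ, hρn, hρinj, hρ⟩ := exists_faithful_unitary_rep (G := G) IG
  have hc := continuous_twist (hγ := hγ) hDc hD
  have hsm : ∀ η ∈ holonomyClosure γ p₀, ContMDiff IP IP ∞ (twist hγ p₀ η) := fun η hη =>
    contMDiff_twist hρ hη
      (hc.comp (continuous_const.prodMk continuous_id : Continuous fun q : P =>
        ((⟨η, hη⟩ : holonomyClosure γ p₀), q)))
  have ho : Continuous fun z => ξ.proj (flow γ z p₀) :=
    ξ.continuous_proj.comp (continuous_flow.comp (continuous_id.prodMk continuous_const))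
  have hcl : IsClosed (periodLattice γ p₀ : Set ℂ) := isClosed_eq ho continuous_const
  obtain ⟨ι, _, b, hb⟩ := exists_lattice_basis hcl hDc
    (fun z => by
      obtain ⟨d, hd, hdz⟩ := hD (ξ.proj (flow γ z p₀))
      exact ⟨d, hd, proj_flow_eq_iff.1 hdz.symm⟩)
    ho (hγ.exists_proj_flow_eq p₀) (fun z w => proj_flow_eq_iff) e'
  -- Second use of `ρ`: restricted to the abelian group `H` it is diagonalizable, and injectivity
  -- makes its finitely many characters separate the points of `H`.
  obtain ⟨s, hs, hsep⟩ := exists_finite_characters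
    (ρ := ρ.comp (holonomyClosure γ p₀).subtype) (fun a v => hρn a v) fun v =>
      ((ContinuousLinearMap.apply ℂ V v).continuous.comp hρ.smooth.continuous).comp
        continuous_subtype_val
  obtain ⟨t, ht, hker⟩ := exists_characters_frameHom (hsm := hsm) (hc := hc) b hb hs
    fun η hη => Subtype.ext (hρinj ((hsep η hη).trans (map_one ρ).symm))
  have : CompactSpace (holonomyClosure γ p₀) :=
    isCompact_iff_compactSpace.1 isClosed_holonomyClosure.isCompact
  have hC : IsCompact ((Multiplicative.toAdd ⁻¹' D) ×ˢ
      (Set.univ : Set (holonomyClosure γ p₀))) :=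
    IsCompact.prod (hDc : IsCompact (X := Multiplicative ℂ) _) isCompact_univ
  -- The torus is the image of `τ`, which may be larger than the closure of `γ(ℂ)`; being compact in
  -- a Hausdorff group it is closed and contains that closure.
  let τ := frameHom hsm hc
  have hcompact : IsCompact (τ.toMonoidHom.range : Set (BundleAut ξ)) := by
    convert hC.image τ.continuous_toFun using 1
    refine subset_antisymm ?_ (Set.image_subset_range _ _)
    rintro _ ⟨x, rfl⟩
    exact exists_frameHom_eq hD x
  have hmem : ∀ z, γ z ∈ τ.toMonoidHom.range := fun z => ⟨(z, 1), frameHom_mk_one z⟩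
  refine ⟨hcompact.of_isClosed_subset isClosed_closure
    (closure_minimal (Set.range_subset_iff.2 hmem) hcompact.isClosed),
    τ.toMonoidHom.range, hcompact.isClosed, ?_,
    ⟨γ.toMonoidHom.codRestrict _ hmem, γ.continuous_toFun.subtype_mk _⟩, fun z => rfl⟩
  exact isTorusGroup_range τ ht hker
    (fun χ hχ k hk hχk => character_eq_one_of_zpow_eq_one χ hχ hk hχk) hC (exists_frameHom_eq hD)
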